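/- Let $(M,g)$ be a compact smooth Riemannian $4$-manifold (without boundary) which is Ricci-flat, i.e. whose Ricci tensor vanishes identically. For $p\in M$ let $K_{\max}(p)$ (respectively $K_{\min}(p)$) denote the maximum (respectively the minimum) of the sectional curvatures of the $2$-dimensional subspaces of $T_pM$. Suppose that there is a constant $c$ with $0\le c<\frac{2+\sqrt6}{4}$ such that $$K_{\max}(p)\ \le\ -c\,K_{\min}(p)\qquad\text{for all } p\in M .$$ Then $(M,g)$ is flat, i.e. its Riemann curvature tensor vanishes identically. -/

import Mathlib

open scoped Manifold ContDiff

noncomputable section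

/-! ### Christoffel symbols and curvature of a metric on a vector space

`G : E → E →L[ℝ] E →L[ℝ] ℝ` is a metric on (an open part of) the model space `E`. The bilinear form
`G y` is also read as the linear map `E → E*`, `u ↦ G y u ·`, so that `(G y).inverse : E* → E`
raises an index. -/

namespace LocalMetric

variable {E : Type*} [NormedAddCommGroup E] [NormedSpace ℝ E] [FiniteDimensional ℝ E]

/-- The Christoffel symbols of `G` at `y` as a bilinear map: `Γ(u, v)` is the vector with
`2 G(Γ(u, v), w) = (∂_u G)(v, w) + (∂_v G)(u, w) - (∂_w G)(u, v)` for all `w`. -/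
def christoffel (G : E → E →L[ℝ] E →L[ℝ] ℝ) (y : E) : E →L[ℝ] E →L[ℝ] E :=
  LinearMap.toContinuousBilinearMap <| LinearMap.mk₂ ℝ
    (fun u v => (1 / 2 : ℝ) • (G y).inverse
      (fderiv ℝ G y u v + fderiv ℝ G y v u - ((fderiv ℝ G y).flip u).flip v))
    (fun u u' v => by
      rw [← smul_add, ← map_add]; congr 2; ext w; simp; ring)
    (fun c u v => by
      rw [smul_comm c, ← map_smul]; simp [smul_sub, smul_add])
    (fun u v v' => by
      rw [← smul_add, ← map_add]; congr 2; ext w; simp; ring)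
    (fun c u v => by
      rw [smul_comm c, ← map_smul]; simp [smul_sub, smul_add])

/-- The curvature of `G` at `y`, as the linear map `u ↦ R(u, v) w`, where
`R(u, v) w = (∂_u Γ)(v, w) - (∂_v Γ)(u, w) + Γ(u, Γ(v, w)) - Γ(v, Γ(u, w))`, that is
`R(u, v) w = ∇_u ∇_v w - ∇_v ∇_u w` for constant vector fields `u`, `v`, `w` on `E`. -/
def curvature (G : E → E →L[ℝ] E →L[ℝ] ℝ) (y v w : E) : E →ₗ[ℝ] E where
  toFun u :=
    fderiv ℝ (christoffel G) y u v w - fderiv ℝ (christoffel G) y v u w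
      + christoffel G y u (christoffel G y v w) - christoffel G y v (christoffel G y u w)
  map_add' u u' := by simp; abel
  map_smul' c u := by simp [smul_sub, smul_add]

end LocalMetric

/-! ### Curvature of a Riemannian manifold -/

namespace Riemannian

variable {E : Type*} [NormedAddCommGroup E] [NormedSpace ℝ E]
  {M : Type*} [TopologicalSpace M] [ChartedSpace E M] [IsManifold 𝓘(ℝ, E) ∞ M]

variable (E M) in
/-- Smooth Riemannian metrics on the smooth manifold `M` without boundary, modelled on `E`. -/
abbrev Metric : Type _ :=
  Bundle.ContMDiffRiemannianMetric 𝓘(ℝ, E) ∞ E (fun x : M => TangentSpace 𝓘(ℝ, E) x)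

/-- The metric `g` in the chart `φ` around `x₀`, i.e. the pullback `(φ⁻¹)^* g`, a metric on the open
subset `φ.target` of `E`. -/
def metricInChart (g : Metric E M) (x₀ : M) (y : E) : E →L[ℝ] E →L[ℝ] ℝ :=
  let φ := extChartAt 𝓘(ℝ, E) x₀
  let A : E →L[ℝ] TangentSpace 𝓘(ℝ, E) (φ.symm y) := mfderiv 𝓘(ℝ, E) 𝓘(ℝ, E) φ.symm y
  (ContinuousLinearMap.precomp ℝ A).comp ((g.inner (φ.symm y)).comp A)

variable [FiniteDimensional ℝ E]

/-- The Riemann curvature tensor of `g` at `p`, as the linear map `u ↦ R(u, v) w` on `T_p M`,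
computed in the chart `φ` around `p`. -/
def curvature (g : Metric E M) (p : M) (v w : TangentSpace 𝓘(ℝ, E) p) :
    TangentSpace 𝓘(ℝ, E) p →ₗ[ℝ] TangentSpace 𝓘(ℝ, E) p :=
  let φ := extChartAt 𝓘(ℝ, E) p
  let D : TangentSpace 𝓘(ℝ, E) p →L[ℝ] E := mfderiv 𝓘(ℝ, E) 𝓘(ℝ, E) φ p
  D.inverse.toLinearMap ∘ₗ LocalMetric.curvature (metricInChart g p) (φ p) (D v) (D w)
    ∘ₗ D.toLinearMap

/-- The Ricci tensor `Ric(v, w) = tr (u ↦ R(u, v) w)`. -/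
def ricci (g : Metric E M) (p : M) (v w : TangentSpace 𝓘(ℝ, E) p) : ℝ :=
  LinearMap.trace ℝ (TangentSpace 𝓘(ℝ, E) p) (curvature g p v w)

/-- The sectional curvature of the plane spanned by linearly independent `u`, `v`. -/
def sectionalCurvature (g : Metric E M) (p : M) (u v : TangentSpace 𝓘(ℝ, E) p) : ℝ :=
  g.inner p (curvature g p v v u) u /
    (g.inner p u u * g.inner p v v - g.inner p u v ^ 2)

/-- The set of the sectional curvatures of all planes in `T_p M`. In dimension at least two it is
nonempty and compact. -/
def sectionalCurvatures (g : Metric E M) (p : M) : Set ℝ :=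
  {k | ∃ u v : TangentSpace 𝓘(ℝ, E) p,
    LinearIndependent ℝ ![u, v] ∧ sectionalCurvature g p u v = k}

/-- The maximum of the sectional curvatures at `p`. -/
def Kmax (g : Metric E M) (p : M) : ℝ := sSup (sectionalCurvatures g p)

/-- The minimum of the sectional curvatures at `p`. -/
def Kmin (g : Metric E M) (p : M) : ℝ := sInf (sectionalCurvatures g p)

/-- The metric `g` is Ricci-flat: its Ricci tensor vanishes. -/
def IsRicciFlat (g : Metric E M) : Prop :=
  ∀ (p : M) (v w : TangentSpace 𝓘(ℝ, E) p), ricci g p v w = 0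

/-- The metric `g` is flat: its Riemann curvature tensor vanishes. -/
def IsFlat (g : Metric E M) : Prop :=
  ∀ (p : M) (u v w : TangentSpace 𝓘(ℝ, E) p), curvature g p v w u = 0

end Riemannian

end

/-! The proof is a maximum principle for the sectional curvature. By compactness the sectional
curvature attains a global minimum `k`, at a point `q` and a plane spanned by orthonormal vectors `b
0`, `b 1`; write `R_ijkl` for `⟨R(b i, b j) b k, b l⟩`, so that `k = R_0110`. Minimality makes the
rough Laplacian of the curvature tensor nonnegative on this plane (`curvatureHess_nonneg_of_min`).

For a Ricci-flat metric the second Bianchi identity and the vanishing divergence of `R` turn that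
Laplacian into commutators of covariant derivatives, which the Ricci identity makes quadratic in `R`
(`sum_hess_eq`). In dimension four, the first-order conditions at the minimal plane and
Ricci-flatness leave six free components, and with `β = R_0123` the inequality becomes
(`sum_hess_critical`) `0 ≤ -3 (k² + β²) + 4 ((R_0220 + k/2)² + R_0221² + R_0230² + (R_0231 +
β/2)²)`. If `κ` bounds the sectional curvatures at `q` from above, the forms `κ |u ∧ v|² - ⟨R(u, v)
v, u⟩` in `u ∈ span (b 0, b 1)`, with `v = b 2` and `v = b 2 + b 3`, are positive semidefinite.
Their discriminants bound the first two squares together, and the last two together, by `(κ +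
k/2)²`. Hence `3 k² ≤ 8 (κ + k/2)²` (`sq_le_of_pinched`).

With `κ = -c k` this reads `3 k² ≤ 8 (c - 1/2)² k²`, and the bound on `c` says exactly that `(c -
1/2)² < 3/8`. So `k = 0`, all sectional curvatures are nonnegative, the pinching makes them
nonpositive as well, and a metric without sectional curvature is flat.

The computation takes place in a chart, corrected quadratically so that the Christoffel symbols
vanish at the base point; there second covariant derivatives have a short coordinate expression. -/

noncomputable section

set_option maxSynthPendingDepth 3

/-! ### Levi-Civita connection and symmetries of the curvature in coordinates. -/

namespace LocalMetric

section Basic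

variable {E : Type*} [NormedAddCommGroup E] [NormedSpace ℝ E]

/-- `G` restricts to a smooth Riemannian metric on the open set `U`. -/
structure IsMetricOn (G : E → E →L[ℝ] E →L[ℝ] ℝ) (U : Set E) : Prop where
  isOpen : IsOpen U
  contDiffOn : ContDiffOn ℝ ∞ G U
  symm : ∀ y ∈ U, ∀ u v, G y u v = G y v u
  pos : ∀ y ∈ U, ∀ u, u ≠ 0 → 0 < G y u u

theorem fderiv_clm_apply_const {F F' : Type*} [NormedAddCommGroup F] [NormedSpace ℝ F]
    [NormedAddCommGroup F'] [NormedSpace ℝ F'] {A : E → F →L[ℝ] F'} {y : E}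
    (hA : DifferentiableAt ℝ A y) (v : F) (u : E) :
    fderiv ℝ (fun x => A x v) y u = fderiv ℝ A y u v := by
  rw [fderiv_clm_apply hA (by fun_prop)]; simp

theorem fderiv_clm_apply₂_const {F F' F'' : Type*} [NormedAddCommGroup F] [NormedSpace ℝ F]
    [NormedAddCommGroup F'] [NormedSpace ℝ F'] [NormedAddCommGroup F''] [NormedSpace ℝ F'']
    {A : E → F →L[ℝ] F' →L[ℝ] F''} {y : E}
    (hA : DifferentiableAt ℝ A y) (v : F) (w : F') (u : E) :
    fderiv ℝ (fun x => A x v w) y u = fderiv ℝ A y u v w := by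
  rw [fderiv_clm_apply_const (by fun_prop), fderiv_clm_apply_const hA]

namespace IsMetricOn

variable {G : E → E →L[ℝ] E →L[ℝ] ℝ} {U : Set E} {y : E}

theorem contDiffAt (hG : IsMetricOn G U) (hy : y ∈ U) : ContDiffAt ℝ ∞ G y :=
  hG.contDiffOn.contDiffAt (hG.isOpen.mem_nhds hy)

theorem differentiableAt (hG : IsMetricOn G U) (hy : y ∈ U) : DifferentiableAt ℝ G y :=
  (hG.contDiffAt hy).differentiableAt (by simp)

theorem fderiv_symm (hG : IsMetricOn G U) (hy : y ∈ U) (u v w : E) :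
    fderiv ℝ G y u v w = fderiv ℝ G y u w v := by
  rw [← fderiv_clm_apply₂_const (hG.differentiableAt hy),
    ← fderiv_clm_apply₂_const (hG.differentiableAt hy)]
  congr 1
  apply Filter.EventuallyEq.fderiv_eq
  filter_upwards [hG.isOpen.mem_nhds hy] with x hx using hG.symm x hx v w

theorem ext_of_apply (hG : IsMetricOn G U) (hy : y ∈ U) {a b : E}
    (h : ∀ w, G y a w = G y b w) : a = b := by
  by_contra hab
  have := hG.pos y hy (a - b) (sub_ne_zero.2 hab)
  rw [(G y).map_sub, sub_apply, h (a - b), sub_self] at this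
  exact lt_irrefl _ this

variable [FiniteDimensional ℝ E]

theorem isInvertible (hG : IsMetricOn G U) (hy : y ∈ U) : (G y).IsInvertible := by
  have hinj : Function.Injective (G y).toLinearMap := fun a b h =>
    hG.ext_of_apply hy fun w => by
      have : G y a = G y b := h
      rw [this]
  have hdim : Module.finrank ℝ E = Module.finrank ℝ (E →L[ℝ] ℝ) := by
    rw [← (LinearMap.toContinuousLinearMap (𝕜 := ℝ) (E := E) (F' := ℝ)).finrank_eq]
    exact (Subspace.dual_finrank_eq (K := ℝ) (V := E)).symm
  refine ⟨(LinearEquiv.ofInjectiveOfFinrankEq _ hinj hdim).toContinuousLinearEquiv, ?_⟩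
  rfl

theorem apply_christoffel (hG : IsMetricOn G U) (hy : y ∈ U) (u v w : E) :
    G y (christoffel G y u v) w =
      (1 / 2 : ℝ) * (fderiv ℝ G y u v w + fderiv ℝ G y v u w - fderiv ℝ G y w u v) := by
  simp only [christoffel, LinearMap.toContinuousBilinearMap_apply, LinearMap.mk₂_apply, map_smul]
  rw [(hG.isInvertible hy).self_apply_inverse]
  simp

theorem christoffel_symm (hG : IsMetricOn G U) (hy : y ∈ U) (u v : E) :
    christoffel G y u v = christoffel G y v u := by
  refine hG.ext_of_apply hy fun w => ?_
  rw [hG.apply_christoffel hy, hG.apply_christoffel hy, hG.fderiv_symm hy w u v]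
  ring

/-- The Levi-Civita connection is compatible with the metric. -/
theorem fderiv_eq (hG : IsMetricOn G U) (hy : y ∈ U) (u v w : E) :
    fderiv ℝ G y u v w = G y (christoffel G y u v) w + G y v (christoffel G y u w) := by
  rw [hG.symm y hy v, hG.apply_christoffel hy, hG.apply_christoffel hy,
    hG.fderiv_symm hy v u w, hG.fderiv_symm hy w u v, hG.fderiv_symm hy u w v]
  ring

theorem contDiffOn_christoffel (hG : IsMetricOn G U) : ContDiffOn ℝ ∞ (christoffel G) U := by
  rw [contDiffOn_clm_apply]
  intro u
  rw [contDiffOn_clm_apply]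
  intro v
  have hd : ContDiffOn ℝ ∞ (fderiv ℝ G) U :=
    hG.contDiffOn.fderiv_of_isOpen hG.isOpen (by simp)
  have hinv : ContDiffOn ℝ ∞ (fun y => (G y).inverse) U := by
    intro y hy
    obtain ⟨e, he⟩ := hG.isInvertible hy
    have h := contDiffAt_map_inverse (n := ∞) e
    rw [he] at h
    exact (h.comp y (hG.contDiffAt hy)).contDiffWithinAt
  have hd1 : ∀ u, ContDiffOn ℝ ∞ (fun y => fderiv ℝ G y u) U := fun u =>
    hd.clm_apply contDiffOn_const
  have hd2 : ∀ u v, ContDiffOn ℝ ∞ (fun y => fderiv ℝ G y u v) U := fun u v =>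
    (hd1 u).clm_apply contDiffOn_const
  have hflip : ContDiffOn ℝ ∞ (fun y => ((fderiv ℝ G y).flip u).flip v) U := by
    rw [contDiffOn_clm_apply]
    intro w
    simpa using (hd2 w u).clm_apply (contDiffOn_const (c := v))
  exact contDiffOn_const.smul (hinv.clm_apply (((hd2 u v).add (hd2 v u)).sub hflip))

theorem contDiffAt_christoffel (hG : IsMetricOn G U) (hy : y ∈ U) :
    ContDiffAt ℝ ∞ (christoffel G) y :=
  hG.contDiffOn_christoffel.contDiffAt (hG.isOpen.mem_nhds hy)

theorem differentiableAt_christoffel (hG : IsMetricOn G U) (hy : y ∈ U) :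
    DifferentiableAt ℝ (christoffel G) y :=
  (hG.contDiffAt_christoffel hy).differentiableAt (by simp)

theorem fderiv_christoffel_symm (hG : IsMetricOn G U) (hy : y ∈ U) (u v w : E) :
    fderiv ℝ (christoffel G) y u v w = fderiv ℝ (christoffel G) y u w v := by
  rw [← fderiv_clm_apply₂_const (hG.differentiableAt_christoffel hy),
    ← fderiv_clm_apply₂_const (hG.differentiableAt_christoffel hy)]
  congr 1
  apply Filter.EventuallyEq.fderiv_eq
  filter_upwards [hG.isOpen.mem_nhds hy] with x hx using hG.christoffel_symm hx v w

theorem curvature_apply (u v w : E) : curvature G y v w u =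
    fderiv ℝ (christoffel G) y u v w - fderiv ℝ (christoffel G) y v u w
      + christoffel G y u (christoffel G y v w) - christoffel G y v (christoffel G y u w) := rfl

theorem curvature_antisymm (u v w : E) : curvature G y v w u = -curvature G y u w v := by
  simp only [curvature_apply]; abel

/-- The first Bianchi identity. -/
theorem curvature_bianchi (hG : IsMetricOn G U) (hy : y ∈ U) (u v w : E) :
    curvature G y v w u + curvature G y w u v + curvature G y u v w = 0 := by
  simp only [curvature_apply]
  rw [hG.fderiv_christoffel_symm hy u w v, hG.fderiv_christoffel_symm hy v w u,
    hG.fderiv_christoffel_symm hy w v u, hG.christoffel_symm hy w v,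
    hG.christoffel_symm hy u w, hG.christoffel_symm hy v u]
  abel

/-- Metric compatibility, differentiated once more. Since second derivatives of `G` commute,
antisymmetrising in `u`, `v` leaves precisely the skewness of the curvature. -/
theorem fderiv_fderiv_apply (hG : IsMetricOn G U) (hy : y ∈ U) (u v w z : E) :
    fderiv ℝ (fderiv ℝ G) y u v w z =
      G y (fderiv ℝ (christoffel G) y u v w) z + G y w (fderiv ℝ (christoffel G) y u v z)
      + G y (christoffel G y u (christoffel G y v w)) z
      + G y (christoffel G y v w) (christoffel G y u z)
      + G y (christoffel G y u w) (christoffel G y v z)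
      + G y w (christoffel G y u (christoffel G y v z)) := by
  have hd : DifferentiableAt ℝ (fderiv ℝ G) y :=
    ((hG.contDiffOn.fderiv_of_isOpen (m := ∞) hG.isOpen (by simp)).contDiffAt
      (hG.isOpen.mem_nhds hy)).differentiableAt (by simp)
  have hΓ := hG.differentiableAt_christoffel hy
  have hGd := hG.differentiableAt hy
  have h1 : fderiv ℝ (fderiv ℝ G) y u v w z =
      fderiv ℝ (fun x => fderiv ℝ G x v w z) y u := by
    rw [fderiv_clm_apply₂_const (hd.clm_apply (differentiableAt_const v)),
      fderiv_clm_apply_const hd]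
  have h2 : (fun x => fderiv ℝ G x v w z) =ᶠ[nhds y] fun x =>
      G x (christoffel G x v w) z + G x w (christoffel G x v z) := by
    filter_upwards [hG.isOpen.mem_nhds hy] with x hx using hG.fderiv_eq hx v w z
  have hc : ∀ w, HasFDerivAt (fun x => christoffel G x v w)
      ((fderiv ℝ (fun x => christoffel G x v w) y)) y := fun w =>
    DifferentiableAt.hasFDerivAt (by fun_prop)
  have e1 := ((hGd.hasFDerivAt.clm_apply (hc w)).clm_apply (hasFDerivAt_const z y))
  have e2 := (((hGd.hasFDerivAt.clm_apply (hasFDerivAt_const w y))).clm_apply (hc z))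
  rw [h1, h2.fderiv_eq, (e1.fun_add e2).fderiv]
  simp [fderiv_clm_apply₂_const hΓ, hG.fderiv_eq hy]
  ring

/-- The curvature is skew-adjoint with respect to the metric. -/
theorem curvature_skew (hG : IsMetricOn G U) (hy : y ∈ U) (u v w z : E) :
    G y (curvature G y v w u) z = -G y (curvature G y v z u) w := by
  have hs : fderiv ℝ (fderiv ℝ G) y u v = fderiv ℝ (fderiv ℝ G) y v u :=
    ((hG.contDiffAt hy).isSymmSndFDerivAt (by simp; exact WithTop.coe_le_coe.2 le_top)) u v
  have h1 := hG.fderiv_fderiv_apply hy u v w z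
  have h2 := hG.fderiv_fderiv_apply hy v u w z
  rw [hs] at h1
  have h3 := h1.symm.trans h2
  rw [hG.symm y hy _ w]
  simp only [curvature_apply, map_add, map_sub, add_apply, sub_apply]
  linear_combination h3

end IsMetricOn

end Basic

/-! ### Naturality of Christoffel symbols and curvature under pullback. -/

section Pullback

variable {E : Type*} [NormedAddCommGroup E] [NormedSpace ℝ E]

/-- On the open set `V`, the metric `G'` is the pullback of the metric `G` on `U` under the
immersion `ψ`. -/
structure IsPullbackOn (G' G : E → E →L[ℝ] E →L[ℝ] ℝ) (ψ : E → E) (V U : Set E) : Prop where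
  isMetricOn : IsMetricOn G U
  isOpen : IsOpen V
  contDiffOn : ContDiffOn ℝ ∞ ψ V
  mapsTo : Set.MapsTo ψ V U
  injective : ∀ x ∈ V, Function.Injective (fderiv ℝ ψ x)
  apply_eq : ∀ x ∈ V, ∀ u v, G' x u v = G (ψ x) (fderiv ℝ ψ x u) (fderiv ℝ ψ x v)

namespace IsPullbackOn

variable {G' G : E → E →L[ℝ] E →L[ℝ] ℝ} {ψ : E → E} {V U : Set E} {x : E}

theorem contDiffOn_fderiv (h : IsPullbackOn G' G ψ V U) : ContDiffOn ℝ ∞ (fderiv ℝ ψ) V :=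
  h.contDiffOn.fderiv_of_isOpen h.isOpen (by simp)

theorem differentiableAt (h : IsPullbackOn G' G ψ V U) (hx : x ∈ V) : DifferentiableAt ℝ ψ x :=
  (h.contDiffOn.contDiffAt (h.isOpen.mem_nhds hx)).differentiableAt (by simp)

theorem differentiableAt_fderiv (h : IsPullbackOn G' G ψ V U) (hx : x ∈ V) :
    DifferentiableAt ℝ (fderiv ℝ ψ) x :=
  (h.contDiffOn_fderiv.contDiffAt (h.isOpen.mem_nhds hx)).differentiableAt (by simp)

theorem fderiv_fderiv_symm (h : IsPullbackOn G' G ψ V U) (hx : x ∈ V) (u v : E) :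
    fderiv ℝ (fderiv ℝ ψ) x u v = fderiv ℝ (fderiv ℝ ψ) x v u :=
  ((h.contDiffOn.contDiffAt (h.isOpen.mem_nhds hx)).isSymmSndFDerivAt
    (by simp; exact WithTop.coe_le_coe.2 le_top)) u v

theorem hasFDerivAt_comp (h : IsPullbackOn G' G ψ V U) (hx : x ∈ V) {F : Type*}
    [NormedAddCommGroup F] [NormedSpace ℝ F] {A : E → F} (hA : DifferentiableAt ℝ A (ψ x)) :
    HasFDerivAt (fun y => A (ψ y)) ((fderiv ℝ A (ψ x)).comp (fderiv ℝ ψ x)) x :=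
  hA.hasFDerivAt.comp x (h.differentiableAt hx).hasFDerivAt

theorem hasFDerivAt_fderiv_apply (h : IsPullbackOn G' G ψ V U) (hx : x ∈ V) (v : E) :
    HasFDerivAt (fun y => fderiv ℝ ψ y v) ((fderiv ℝ (fderiv ℝ ψ) x).flip v) x := by
  simpa using (h.differentiableAt_fderiv hx).hasFDerivAt.clm_apply (hasFDerivAt_const v x)

variable [FiniteDimensional ℝ E]

theorem isMetricOn_pullback (h : IsPullbackOn G' G ψ V U) : IsMetricOn G' V where
  isOpen := h.isOpen
  contDiffOn := by
    rw [contDiffOn_clm_apply]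
    intro u
    rw [contDiffOn_clm_apply]
    intro v
    refine ContDiffOn.congr ?_ fun x hx => h.apply_eq x hx u v
    exact ((h.isMetricOn.contDiffOn.comp h.contDiffOn h.mapsTo).clm_apply
      (h.contDiffOn_fderiv.clm_apply contDiffOn_const)).clm_apply
      (h.contDiffOn_fderiv.clm_apply contDiffOn_const)
  symm x hx u v := by
    rw [h.apply_eq x hx, h.apply_eq x hx, h.isMetricOn.symm _ (h.mapsTo hx)]
  pos x hx u hu := by
    rw [h.apply_eq x hx]
    exact h.isMetricOn.pos _ (h.mapsTo hx) _ fun h0 => hu (h.injective x hx (by simpa using h0))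

theorem fderiv_apply (h : IsPullbackOn G' G ψ V U) (hx : x ∈ V) (u v w : E) :
    fderiv ℝ G' x u v w =
      fderiv ℝ G (ψ x) (fderiv ℝ ψ x u) (fderiv ℝ ψ x v) (fderiv ℝ ψ x w)
      + G (ψ x) (fderiv ℝ (fderiv ℝ ψ) x u v) (fderiv ℝ ψ x w)
      + G (ψ x) (fderiv ℝ ψ x v) (fderiv ℝ (fderiv ℝ ψ) x u w) := by
  rw [← fderiv_clm_apply₂_const (h.isMetricOn_pullback.differentiableAt hx)]
  have he : (fun x => G' x v w) =ᶠ[nhds x]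
      fun x => G (ψ x) (fderiv ℝ ψ x v) (fderiv ℝ ψ x w) := by
    filter_upwards [h.isOpen.mem_nhds hx] with y hy using h.apply_eq y hy v w
  rw [he.fderiv_eq, (((h.hasFDerivAt_comp hx
    (h.isMetricOn.differentiableAt (h.mapsTo hx))).clm_apply
    (h.hasFDerivAt_fderiv_apply hx v)).clm_apply (h.hasFDerivAt_fderiv_apply hx w)).fderiv]
  simp
  ring

/-- Transformation law of the Christoffel symbols. -/
theorem fderiv_christoffel_apply (h : IsPullbackOn G' G ψ V U) (hx : x ∈ V) (u v : E) :
    fderiv ℝ ψ x (christoffel G' x u v) = fderiv ℝ (fderiv ℝ ψ) x u v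
      + christoffel G (ψ x) (fderiv ℝ ψ x u) (fderiv ℝ ψ x v) := by
  have hψ := h.mapsTo hx
  have hG := h.isMetricOn
  refine hG.ext_of_apply hψ fun w => ?_
  obtain ⟨w, rfl⟩ : ∃ w', fderiv ℝ ψ x w' = w :=
    (LinearMap.injective_iff_surjective (f := (fderiv ℝ ψ x).toLinearMap)).1 (h.injective x hx) w
  rw [← h.apply_eq x hx, h.isMetricOn_pullback.apply_christoffel hx, h.fderiv_apply hx,
    h.fderiv_apply hx, h.fderiv_apply hx, map_add, add_apply, hG.apply_christoffel hψ,
    h.fderiv_fderiv_symm hx v u, h.fderiv_fderiv_symm hx w u, h.fderiv_fderiv_symm hx w v,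
    hG.symm _ hψ (fderiv ℝ ψ x v), hG.symm _ hψ (fderiv ℝ ψ x u)]
  ring

/-- Naturality of the curvature. -/
theorem fderiv_curvature_apply (h : IsPullbackOn G' G ψ V U) (hx : x ∈ V) (u v w : E) :
    fderiv ℝ ψ x (curvature G' x v w u) =
      curvature G (ψ x) (fderiv ℝ ψ x v) (fderiv ℝ ψ x w) (fderiv ℝ ψ x u) := by
  have hψ := h.mapsTo hx
  have hΓ := h.isMetricOn.differentiableAt_christoffel hψ
  have hΓ' := h.isMetricOn_pullback.differentiableAt_christoffel hx
  have hdd : ContDiffAt ℝ ∞ (fderiv ℝ ψ) x :=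
    h.contDiffOn_fderiv.contDiffAt (h.isOpen.mem_nhds hx)
  have hd2 : DifferentiableAt ℝ (fderiv ℝ (fderiv ℝ ψ)) x :=
    ((h.contDiffOn_fderiv.fderiv_of_isOpen (m := ∞) h.isOpen (by simp)).contDiffAt
      (h.isOpen.mem_nhds hx)).differentiableAt (by simp)
  -- This is the transformation law of the Christoffel symbols differentiated in the direction `a`.
  -- Antisymmetrising it in `a`, `u` removes the third derivatives of `ψ`.
  have key : ∀ a u v,
      fderiv ℝ (fderiv ℝ ψ) x a (christoffel G' x u v)
        + fderiv ℝ ψ x (fderiv ℝ (christoffel G') x a u v) =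
      fderiv ℝ (fderiv ℝ (fderiv ℝ ψ)) x a u v
        + fderiv ℝ (christoffel G) (ψ x) (fderiv ℝ ψ x a) (fderiv ℝ ψ x u) (fderiv ℝ ψ x v)
        + christoffel G (ψ x) (fderiv ℝ (fderiv ℝ ψ) x a u) (fderiv ℝ ψ x v)
        + christoffel G (ψ x) (fderiv ℝ ψ x u) (fderiv ℝ (fderiv ℝ ψ) x a v) := by
    intro a u v
    have he : (fun y => fderiv ℝ ψ y (christoffel G' y u v)) =ᶠ[nhds x]
        fun y => fderiv ℝ (fderiv ℝ ψ) y u v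
          + christoffel G (ψ y) (fderiv ℝ ψ y u) (fderiv ℝ ψ y v) := by
      filter_upwards [h.isOpen.mem_nhds hx] with y hy using h.fderiv_christoffel_apply hy u v
    have e1 := (h.differentiableAt_fderiv hx).hasFDerivAt.clm_apply
      ((hΓ'.hasFDerivAt.clm_apply (hasFDerivAt_const u x)).clm_apply (hasFDerivAt_const v x))
    have e2 := ((hd2.hasFDerivAt.clm_apply (hasFDerivAt_const u x)).clm_apply
      (hasFDerivAt_const v x)).fun_add (((h.hasFDerivAt_comp hx hΓ).clm_apply
      (h.hasFDerivAt_fderiv_apply hx u)).clm_apply (h.hasFDerivAt_fderiv_apply hx v))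
    have := congrArg (fun A : E →L[ℝ] E => A a)
      (e1.fderiv.symm.trans (he.fderiv_eq.trans e2.fderiv))
    simp only [add_apply, ContinuousLinearMap.comp_apply,
      ContinuousLinearMap.flip_apply, zero_apply, map_zero, zero_add] at this
    rw [add_comm, this]
    abel
  have h3 : fderiv ℝ (fderiv ℝ (fderiv ℝ ψ)) x u v = fderiv ℝ (fderiv ℝ (fderiv ℝ ψ)) x v u :=
    (hdd.isSymmSndFDerivAt (by simp; exact WithTop.coe_le_coe.2 le_top)) u v
  have k1 := key u v w
  have k2 := key v u w
  rw [h3] at k1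
  rw [h.fderiv_fderiv_symm hx v u] at k2
  simp only [IsMetricOn.curvature_apply, map_add, map_sub, h.fderiv_christoffel_apply hx]
  rw [eq_sub_of_add_eq' k1, eq_sub_of_add_eq' k2]
  abel

end IsPullbackOn

end Pullback

/-! ### Calculus of second derivatives. -/

section SecondDerivative

variable {E : Type*} [NormedAddCommGroup E] [NormedSpace ℝ E]

theorem fderiv_fderiv_clm_apply {F F' : Type*} [NormedAddCommGroup F] [NormedSpace ℝ F]
    [NormedAddCommGroup F'] [NormedSpace ℝ F'] {f : E → F →L[ℝ] F'} {g : E → F} {y : E}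
    (hf : ContDiffAt ℝ ∞ f y) (hg : ContDiffAt ℝ ∞ g y) (m n : E) :
    fderiv ℝ (fderiv ℝ (fun x => f x (g x))) y m n =
      f y (fderiv ℝ (fderiv ℝ g) y m n) + fderiv ℝ f y m (fderiv ℝ g y n)
      + fderiv ℝ f y n (fderiv ℝ g y m) + fderiv ℝ (fderiv ℝ f) y m n (g y) := by
  have hf' : ContDiffAt ℝ ∞ (fderiv ℝ f) y := hf.fderiv_right (by simp)
  have hg' : ContDiffAt ℝ ∞ (fderiv ℝ g) y := hg.fderiv_right (by simp)
  have hfg : ContDiffAt ℝ ∞ (fun x => f x (g x)) y := hf.clm_apply hg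
  have hfg' : DifferentiableAt ℝ (fderiv ℝ (fun x => f x (g x))) y :=
    (hfg.fderiv_right (m := ∞) (by simp)).differentiableAt (by simp)
  have hev : (fun x => fderiv ℝ (fun x => f x (g x)) x n) =ᶠ[nhds y]
      fun x => f x (fderiv ℝ g x n) + fderiv ℝ f x n (g x) := by
    have h1 := (hf.of_le (m := 1) (by simp)).eventually (by simp)
    have h2 := (hg.of_le (m := 1) (by simp)).eventually (by simp)
    filter_upwards [h1, h2] with x h1 h2
    rw [fderiv_clm_apply (h1.differentiableAt (by simp)) (h2.differentiableAt (by simp))]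
    simp
  rw [← fderiv_clm_apply_const hfg', hev.fderiv_eq]
  have df := hf.differentiableAt (by simp)
  have dg := hg.differentiableAt (by simp)
  have df' := hf'.differentiableAt (by simp)
  have dg' := hg'.differentiableAt (by simp)
  have e := (df.hasFDerivAt.clm_apply (dg'.hasFDerivAt.clm_apply (hasFDerivAt_const n y))).fun_add
    ((df'.hasFDerivAt.clm_apply (hasFDerivAt_const n y)).clm_apply dg.hasFDerivAt)
  rw [e.fderiv]
  simp
  abel

theorem fderiv_fderiv_clm_apply_const {F F' : Type*} [NormedAddCommGroup F] [NormedSpace ℝ F]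
    [NormedAddCommGroup F'] [NormedSpace ℝ F'] {f : E → F →L[ℝ] F'} {y : E}
    (hf : ContDiffAt ℝ ∞ f y) (v : F) (m n : E) :
    fderiv ℝ (fderiv ℝ (fun x => f x v)) y m n = fderiv ℝ (fderiv ℝ f) y m n v := by
  rw [fderiv_fderiv_clm_apply hf contDiffAt_const]
  simp

theorem fderiv_fderiv_symm {F : Type*} [NormedAddCommGroup F] [NormedSpace ℝ F] {f : E → F}
    {y : E} (hf : ContDiffAt ℝ ∞ f y) (m n : E) :
    fderiv ℝ (fderiv ℝ f) y m n = fderiv ℝ (fderiv ℝ f) y n m :=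
  (hf.isSymmSndFDerivAt (by simp; exact WithTop.coe_le_coe.2 le_top)) m n

theorem fderiv_fderiv_add {F : Type*} [NormedAddCommGroup F] [NormedSpace ℝ F] {f g : E → F}
    {y : E} (hf : ContDiffAt ℝ ∞ f y) (hg : ContDiffAt ℝ ∞ g y) (m n : E) :
    fderiv ℝ (fderiv ℝ (fun x => f x + g x)) y m n =
      fderiv ℝ (fderiv ℝ f) y m n + fderiv ℝ (fderiv ℝ g) y m n := by
  have hev : fderiv ℝ (fun x => f x + g x) =ᶠ[nhds y] fun x => fderiv ℝ f x + fderiv ℝ g x := by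
    have h1 := (hf.of_le (m := 1) (by simp)).eventually (by simp)
    have h2 := (hg.of_le (m := 1) (by simp)).eventually (by simp)
    filter_upwards [h1, h2] with x h1 h2
    exact fderiv_fun_add (h1.differentiableAt (by simp)) (h2.differentiableAt (by simp))
  rw [hev.fderiv_eq, fderiv_fun_add]
  · simp
  · exact (hf.fderiv_right (m := ∞) (by simp)).differentiableAt (by simp)
  · exact (hg.fderiv_right (m := ∞) (by simp)).differentiableAt (by simp)

theorem fderiv_fderiv_const_smul {F : Type*} [NormedAddCommGroup F] [NormedSpace ℝ F] {f : E → F}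
    {y : E} (hf : ContDiffAt ℝ ∞ f y) (c : ℝ) (m n : E) :
    fderiv ℝ (fderiv ℝ (fun x => c • f x)) y m n = c • fderiv ℝ (fderiv ℝ f) y m n := by
  have hev : fderiv ℝ (fun x => c • f x) =ᶠ[nhds y] fun x => c • fderiv ℝ f x := by
    have h1 := (hf.of_le (m := 1) (by simp)).eventually (by simp)
    filter_upwards [h1] with x h1
    exact fderiv_fun_const_smul (h1.differentiableAt (by simp)) c
  rw [hev.fderiv_eq, fderiv_fun_const_smul]
  · simp
  · exact (hf.fderiv_right (m := ∞) (by simp)).differentiableAt (by simp)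

theorem fderiv_fderiv_sub {F : Type*} [NormedAddCommGroup F] [NormedSpace ℝ F] {f g : E → F}
    {y : E} (hf : ContDiffAt ℝ ∞ f y) (hg : ContDiffAt ℝ ∞ g y) (m n : E) :
    fderiv ℝ (fderiv ℝ (fun x => f x - g x)) y m n =
      fderiv ℝ (fderiv ℝ f) y m n - fderiv ℝ (fderiv ℝ g) y m n := by
  have := fderiv_fderiv_add hf (hg.const_smul (-1 : ℝ)) m n
  rw [fderiv_fderiv_const_smul hg] at this
  simpa [sub_eq_add_neg] using this

end SecondDerivative

/-! ### Second covariant derivative of the curvature where the Christoffel symbols vanish. -/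

section Jets

variable {E : Type*} [NormedAddCommGroup E] [NormedSpace ℝ E] [FiniteDimensional ℝ E]

/-- At a point where the Christoffel symbols vanish, the second covariant derivative
`(∇²_{m,n} R)(u, v) w` of the curvature. -/
def curvatureHess (G : E → E →L[ℝ] E →L[ℝ] ℝ) (y m n u v w : E) : E :=
  fderiv ℝ (fderiv ℝ fun x => curvature G x v w u) y m n
    + fderiv ℝ (christoffel G) y m n (curvature G y v w u)
    - curvature G y v w (fderiv ℝ (christoffel G) y m n u)
    - curvature G y (fderiv ℝ (christoffel G) y m n v) w u
    - curvature G y v (fderiv ℝ (christoffel G) y m n w) u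

namespace IsMetricOn

variable {G : E → E →L[ℝ] E →L[ℝ] ℝ} {U : Set E} {y : E}

theorem contDiffAt_fderiv_christoffel (hG : IsMetricOn G U) (hy : y ∈ U) :
    ContDiffAt ℝ ∞ (fderiv ℝ (christoffel G)) y :=
  (hG.contDiffAt_christoffel hy).fderiv_right (by simp)

theorem contDiffAt_fderiv_christoffel_apply (hG : IsMetricOn G U) (hy : y ∈ U) (u v w : E) :
    ContDiffAt ℝ ∞ (fun x => fderiv ℝ (christoffel G) x u v w) y :=
  (((hG.contDiffAt_fderiv_christoffel hy).clm_apply contDiffAt_const).clm_apply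
    contDiffAt_const).clm_apply contDiffAt_const

theorem contDiffAt_christoffel_apply (hG : IsMetricOn G U) (hy : y ∈ U) (u v : E) :
    ContDiffAt ℝ ∞ (fun x => christoffel G x u v) y :=
  ((hG.contDiffAt_christoffel hy).clm_apply contDiffAt_const).clm_apply contDiffAt_const

theorem contDiffAt_christoffel_christoffel (hG : IsMetricOn G U) (hy : y ∈ U) (u v w : E) :
    ContDiffAt ℝ ∞ (fun x => christoffel G x u (christoffel G x v w)) y :=
  ((hG.contDiffAt_christoffel hy).clm_apply contDiffAt_const).clm_apply
    (hG.contDiffAt_christoffel_apply hy v w)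

theorem contDiffAt_curvature (hG : IsMetricOn G U) (hy : y ∈ U) (u v w : E) :
    ContDiffAt ℝ ∞ (fun x => curvature G x v w u) y :=
  (((hG.contDiffAt_fderiv_christoffel_apply hy u v w).sub
    (hG.contDiffAt_fderiv_christoffel_apply hy v u w)).add
    (hG.contDiffAt_christoffel_christoffel hy u v w)).sub
    (hG.contDiffAt_christoffel_christoffel hy v u w)

theorem fderiv_fderiv_christoffel_christoffel (hG : IsMetricOn G U) (hy : y ∈ U)
    (hΓ : christoffel G y = 0) (m n u v w : E) :
    fderiv ℝ (fderiv ℝ fun x => christoffel G x u (christoffel G x v w)) y m n =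
      fderiv ℝ (christoffel G) y m u (fderiv ℝ (christoffel G) y n v w)
      + fderiv ℝ (christoffel G) y n u (fderiv ℝ (christoffel G) y m v w) := by
  have hd := hG.differentiableAt_christoffel hy
  rw [fderiv_fderiv_clm_apply ((hG.contDiffAt_christoffel hy).clm_apply contDiffAt_const)
    (hG.contDiffAt_christoffel_apply hy v w)]
  simp [hΓ, fderiv_clm_apply_const hd, fderiv_clm_apply₂_const hd]

theorem fderiv_fderiv_curvature (hG : IsMetricOn G U) (hy : y ∈ U)
    (hΓ : christoffel G y = 0) (m n u v w : E) :
    fderiv ℝ (fderiv ℝ fun x => curvature G x v w u) y m n =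
      fderiv ℝ (fderiv ℝ (fderiv ℝ (christoffel G))) y m n u v w
      - fderiv ℝ (fderiv ℝ (fderiv ℝ (christoffel G))) y m n v u w
      + (fderiv ℝ (christoffel G) y m u (fderiv ℝ (christoffel G) y n v w)
        + fderiv ℝ (christoffel G) y n u (fderiv ℝ (christoffel G) y m v w))
      - (fderiv ℝ (christoffel G) y m v (fderiv ℝ (christoffel G) y n u w)
        + fderiv ℝ (christoffel G) y n v (fderiv ℝ (christoffel G) y m u w)) := by
  have c1 := hG.contDiffAt_fderiv_christoffel_apply hy
  have c2 := hG.contDiffAt_christoffel_christoffel hy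
  have h3 : ∀ u v w, fderiv ℝ (fderiv ℝ fun x => fderiv ℝ (christoffel G) x u v w) y m n =
      fderiv ℝ (fderiv ℝ (fderiv ℝ (christoffel G))) y m n u v w := by
    intro u v w
    have c := hG.contDiffAt_fderiv_christoffel hy
    rw [fderiv_fderiv_clm_apply_const
        ((c.clm_apply contDiffAt_const).clm_apply contDiffAt_const),
      fderiv_fderiv_clm_apply_const (c.clm_apply contDiffAt_const),
      fderiv_fderiv_clm_apply_const c]
  simp only [curvature_apply]
  rw [fderiv_fderiv_sub (((c1 u v w).sub (c1 v u w)).add (c2 u v w)) (c2 v u w),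
    fderiv_fderiv_add ((c1 u v w).sub (c1 v u w)) (c2 u v w),
    fderiv_fderiv_sub (c1 u v w) (c1 v u w), h3, h3,
    hG.fderiv_fderiv_christoffel_christoffel hy hΓ,
    hG.fderiv_fderiv_christoffel_christoffel hy hΓ]

theorem curvature_apply_of_christoffel_eq_zero (hΓ : christoffel G y = 0) (u v w : E) :
    curvature G y v w u =
      fderiv ℝ (christoffel G) y u v w - fderiv ℝ (christoffel G) y v u w := by
  simp [curvature_apply, hΓ]

theorem fderiv_fderiv_fderiv_christoffel_symm (hG : IsMetricOn G U) (hy : y ∈ U) (m n u : E) :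
    fderiv ℝ (fderiv ℝ (fderiv ℝ (christoffel G))) y m n u =
      fderiv ℝ (fderiv ℝ (fderiv ℝ (christoffel G))) y m u n := by
  have hd : DifferentiableAt ℝ (fderiv ℝ (fderiv ℝ (christoffel G))) y :=
    ((hG.contDiffAt_fderiv_christoffel hy).fderiv_right (m := ∞) (by simp)).differentiableAt
      (by simp)
  rw [← fderiv_clm_apply₂_const hd, ← fderiv_clm_apply₂_const hd]
  congr 1
  apply Filter.EventuallyEq.fderiv_eq
  filter_upwards [hG.isOpen.mem_nhds hy] with x hx
    using fderiv_fderiv_symm (hG.contDiffAt_christoffel hx) n u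

/-- The second covariant derivative of the curvature in terms of derivatives of the Christoffel
symbols. -/
theorem exists_curvatureHess_eq (hG : IsMetricOn G U) (hy : y ∈ U) (hΓ : christoffel G y = 0) :
    ∃ (H : E → E → E → E) (X : E → E → E → E → E → E),
      (∀ m n u v w, curvatureHess G y m n u v w =
        X m n u v w - X m n v u w + (H m u (H n v w) + H n u (H m v w))
        - (H m v (H n u w) + H n v (H m u w)) + (H m n (H u v w) - H m n (H v u w))
        - (H (H m n u) v w - H v (H m n u) w) - (H u (H m n v) w - H (H m n v) u w)
        - (H u v (H m n w) - H v u (H m n w))) ∧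
      (∀ m u v, H m u v = H m v u) ∧ ∀ m n u v w, X m n u v w = X m u n v w := by
  -- First and third derivatives of the Christoffel symbols are reduced to bare functions of vectors
  -- with their symmetries, so that the identities below become formal cancellations.
  refine ⟨fun m u v => fderiv ℝ (christoffel G) y m u v,
    fun m n u v w => fderiv ℝ (fderiv ℝ (fderiv ℝ (christoffel G))) y m n u v w,
    fun m n u v w => ?_,
    hG.fderiv_christoffel_symm hy, fun m n u v w => ?_⟩
  · simp only [curvatureHess, hG.fderiv_fderiv_curvature hy hΓ,
      curvature_apply_of_christoffel_eq_zero hΓ, ContinuousLinearMap.map_sub]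
  · dsimp only
    rw [hG.fderiv_fderiv_fderiv_christoffel_symm hy m n u]

theorem curvatureHess_antisymm (hG : IsMetricOn G U) (hy : y ∈ U)
    (hΓ : christoffel G y = 0) (m n u v w : E) :
    curvatureHess G y m n u v w = -curvatureHess G y m n v u w := by
  obtain ⟨H, X, h, -, -⟩ := hG.exists_curvatureHess_eq hy hΓ
  rw [h, h]
  abel

/-- The second Bianchi identity, differentiated once. -/
theorem curvatureHess_bianchi₂ (hG : IsMetricOn G U) (hy : y ∈ U)
    (hΓ : christoffel G y = 0) (m i j k w : E) :
    curvatureHess G y m i j k w + curvatureHess G y m j k i w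
      + curvatureHess G y m k i j w = 0 := by
  obtain ⟨H, X, h, hH, hX⟩ := hG.exists_curvatureHess_eq hy hΓ
  rw [h, h, h, hX m j i, hX m k i, hX m k j, hH m i j, hH m j k, hH m i k]
  abel

/-- The Ricci identity. -/
theorem curvatureHess_sub_symm (hG : IsMetricOn G U) (hy : y ∈ U)
    (hΓ : christoffel G y = 0) (m n u v w : E) :
    curvatureHess G y m n u v w - curvatureHess G y n m u v w =
      curvature G y n (curvature G y v w u) m - curvature G y v w (curvature G y n u m)
      - curvature G y (curvature G y n v m) w u - curvature G y v (curvature G y n w m) u := by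
  simp only [curvatureHess]
  rw [fderiv_fderiv_symm (hG.contDiffAt_curvature hy u v w) m n]
  simp only [curvature_apply_of_christoffel_eq_zero hΓ, map_sub, sub_apply]
  abel

/-- The first Bianchi identity holds near `y`, so its second derivatives vanish; each group of
correction terms cancels by the same identity at `y`. -/
theorem curvatureHess_bianchi₁ (hG : IsMetricOn G U) (hy : y ∈ U)
    (m n u v w : E) :
    curvatureHess G y m n u v w + curvatureHess G y m n v w u
      + curvatureHess G y m n w u v = 0 := by
  have h0 : fderiv ℝ (fderiv ℝ fun x => curvature G x v w u) y m n
      + fderiv ℝ (fderiv ℝ fun x => curvature G x w u v) y m n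
      + fderiv ℝ (fderiv ℝ fun x => curvature G x u v w) y m n = 0 := by
    have c := hG.contDiffAt_curvature hy
    rw [← fderiv_fderiv_add (c u v w) (c v w u),
      ← fderiv_fderiv_add ((c u v w).add (c v w u)) (c w u v)]
    have : (fun x => curvature G x v w u + curvature G x w u v + curvature G x u v w)
        =ᶠ[nhds y] fun _ => 0 := by
      filter_upwards [hG.isOpen.mem_nhds hy] with x hx using hG.curvature_bianchi hx u v w
    rw [this.fderiv.fderiv_eq]
    simp
  have b := hG.curvature_bianchi hy
  have e0 := congrArg (fderiv ℝ (christoffel G) y m n) (b u v w)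
  have e1 := b (fderiv ℝ (christoffel G) y m n u) v w
  have e2 := b u (fderiv ℝ (christoffel G) y m n v) w
  have e3 := b u v (fderiv ℝ (christoffel G) y m n w)
  simp only [map_add, map_zero] at e0
  simp only [curvatureHess]
  linear_combination (norm := module) h0 + e0 - e1 - e2 - e3

theorem fderiv_eq_zero (hG : IsMetricOn G U) (hy : y ∈ U) (hΓ : christoffel G y = 0) :
    fderiv ℝ G y = 0 := by
  ext u v w
  simp [hG.fderiv_eq hy, hΓ]

theorem fderiv_fderiv_apply_of_christoffel_eq_zero (hG : IsMetricOn G U) (hy : y ∈ U)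
    (hΓ : christoffel G y = 0) (u v w z : E) :
    fderiv ℝ (fderiv ℝ G) y u v w z =
      G y (fderiv ℝ (christoffel G) y u v w) z + G y w (fderiv ℝ (christoffel G) y u v z) := by
  simp [hG.fderiv_fderiv_apply hy, hΓ]

/-- Second derivatives of the fully covariant curvature tensor. -/
theorem fderiv_fderiv_curvature_inner (hG : IsMetricOn G U) (hy : y ∈ U)
    (hΓ : christoffel G y = 0) (m n u v w z : E) :
    fderiv ℝ (fderiv ℝ fun x => G x (curvature G x v w u) z) y m n =
      G y (fderiv ℝ (fderiv ℝ fun x => curvature G x v w u) y m n) z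
      + G y (fderiv ℝ (christoffel G) y m n (curvature G y v w u)) z
      + G y (curvature G y v w u) (fderiv ℝ (christoffel G) y m n z) := by
  have c := hG.contDiffAt_curvature hy u v w
  rw [fderiv_fderiv_clm_apply_const ((hG.contDiffAt hy).clm_apply c),
    fderiv_fderiv_clm_apply (hG.contDiffAt hy) c, hG.fderiv_eq_zero hy hΓ]
  simp [hG.fderiv_fderiv_apply_of_christoffel_eq_zero hy hΓ]
  ring

theorem curvatureHess_skew (hG : IsMetricOn G U) (hy : y ∈ U)
    (hΓ : christoffel G y = 0) (m n u v w z : E) :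
    G y (curvatureHess G y m n u v w) z = -G y (curvatureHess G y m n u v z) w := by
  have h0 : fderiv ℝ (fderiv ℝ fun x => G x (curvature G x v w u) z) y m n =
      -fderiv ℝ (fderiv ℝ fun x => G x (curvature G x v z u) w) y m n := by
    have c : ContDiffAt ℝ ∞ (fun x => G x (curvature G x v z u) w) y :=
      ((hG.contDiffAt hy).clm_apply (hG.contDiffAt_curvature hy u v z)).clm_apply contDiffAt_const
    have := fderiv_fderiv_const_smul c (-1) m n
    rw [neg_one_smul] at this
    rw [← this]
    have he : (fun x => G x (curvature G x v w u) z) =ᶠ[nhds y]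
        fun x => (-1 : ℝ) • G x (curvature G x v z u) w := by
      filter_upwards [hG.isOpen.mem_nhds hy] with x hx
      rw [hG.curvature_skew hx, neg_one_smul]
    rw [he.fderiv.fderiv_eq]
  rw [hG.fderiv_fderiv_curvature_inner hy hΓ, hG.fderiv_fderiv_curvature_inner hy hΓ] at h0
  simp only [curvatureHess, map_add, map_sub, add_apply, sub_apply]
  have s := hG.curvature_skew hy
  have s1 := s (fderiv ℝ (christoffel G) y m n u) v w z
  have s2 := s u (fderiv ℝ (christoffel G) y m n v) w z
  have s3 := s u v (fderiv ℝ (christoffel G) y m n w) z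
  have s4 := s u v (fderiv ℝ (christoffel G) y m n z) w
  linear_combination h0 - s1 - s2 - s3 - s4

/-- Second derivatives commute with the trace. Of the correction terms, those in `v` and `w` are
again Ricci contractions, and the other two cancel because `tr (H ∘ R) = tr (R ∘ H)`. -/
theorem sum_curvatureHess_eq_zero (hG : IsMetricOn G U) (hy : y ∈ U)
    {ι : Type*} [Fintype ι] (b : Module.Basis ι ℝ E)
    (hRic : ∀ x ∈ U, ∀ v w, LinearMap.trace ℝ E (curvature G x v w) = 0) (m n v w : E) :
    ∑ i, b.repr (curvatureHess G y m n (b i) v w) i = 0 := by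
  classical
  have tr : ∀ f : E →ₗ[ℝ] E, LinearMap.trace ℝ E f = ∑ i, b.repr (f (b i)) i := fun f => by
    simp [LinearMap.trace_eq_matrix_trace ℝ b, Matrix.trace, LinearMap.toMatrix_apply]
  have ℓ : ∀ i, ∃ ℓ : E →L[ℝ] ℝ, ∀ x, b.repr x i = ℓ x := fun i =>
    ⟨LinearMap.toContinuousLinearMap (b.coord i), fun x => by simp⟩
  choose ℓ hℓ using ℓ
  have c := fun i => hG.contDiffAt_curvature hy (b i) v w
  have h0 : ∑ i, b.repr (fderiv ℝ (fderiv ℝ fun x => curvature G x v w (b i)) y m n) i = 0 := by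
    have h1 : ∀ i, b.repr (fderiv ℝ (fderiv ℝ fun x => curvature G x v w (b i)) y m n) i =
        fderiv ℝ (fderiv ℝ fun x => ℓ i (curvature G x v w (b i))) y m n := fun i => by
      rw [fderiv_fderiv_clm_apply contDiffAt_const (c i)]
      simp [hℓ]
    have h2 : ∀ s : Finset ι, ∑ i ∈ s, fderiv ℝ (fderiv ℝ fun x =>
        ℓ i (curvature G x v w (b i))) y m n =
        fderiv ℝ (fderiv ℝ fun x => ∑ i ∈ s, ℓ i (curvature G x v w (b i))) y m n := by
      intro s
      induction s using Finset.induction_on with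
      | empty => simp
      | insert a s ha ih =>
        simp only [Finset.sum_insert ha]
        rw [ih, fderiv_fderiv_add (contDiffAt_const.clm_apply (c a))
          (ContDiffAt.sum fun i _ => contDiffAt_const.clm_apply (c i))]
    simp only [h1]
    rw [h2]
    have he : (fun x => ∑ i, ℓ i (curvature G x v w (b i))) =ᶠ[nhds y] fun _ => 0 := by
      filter_upwards [hG.isOpen.mem_nhds hy] with x hx
      simp only [← hℓ]
      rw [← tr, hRic x hx]
    rw [he.fderiv.fderiv_eq]
    simp
  set H : E →L[ℝ] E := fderiv ℝ (christoffel G) y m n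
  have h1 : ∑ i, b.repr (H (curvature G y v w (b i))) i
      = ∑ i, b.repr (curvature G y v w (H (b i))) i := by
    have := LinearMap.trace_mul_comm ℝ H.toLinearMap (curvature G y v w)
    rw [tr, tr] at this
    exact this
  have h2 := hRic y hy (H v) w
  have h3 := hRic y hy v (H w)
  rw [tr] at h2 h3
  simp only [curvatureHess, map_add, map_sub, Finsupp.add_apply, Finsupp.sub_apply,
    Finset.sum_add_distrib, Finset.sum_sub_distrib]
  rw [h0, h2, h3, h1]
  ring

end IsMetricOn

end Jets

end LocalMetric

/-! ### Algebra of Ricci-flat curvature tensors and the quadratic reaction term. -/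

/-- A curvature-like tensor is symmetric under exchange of its two pairs of arguments. -/
theorem curvature_pair_symm {ι : Type*} {T : ι → ι → ι → ι → ℝ}
    (antisymm : ∀ i j k l, T i j k l = -T j i k l) (skew : ∀ i j k l, T i j k l = -T i j l k)
    (bianchi : ∀ i j k l, T i j k l + T j k i l + T k i j l = 0) (i j k l : ι) :
    T i j k l = T k l i j := by
  linarith [bianchi i j k l, bianchi j k l i, bianchi k l i j, bianchi l i j k,
    antisymm i j k l, antisymm k l i j, skew i j k l, skew k l i j,
    antisymm j k i l, skew j k i l, antisymm k i j l, skew k i j l,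
    antisymm k l j i, antisymm l j k i, skew l j k i, antisymm j k l i, skew j k l i,
    antisymm l i k j, skew l i k j, antisymm i k l j, skew i k l j,
    antisymm i j l k, skew i j l k, antisymm j l i k, skew j l i k,
    antisymm l i j k, skew l i j k]

/-- The components of an algebraic curvature tensor with vanishing Ricci contraction. -/
structure IsWeylTensor {ι : Type*} [Fintype ι] (T : ι → ι → ι → ι → ℝ) : Prop where
  antisymm : ∀ i j k l, T i j k l = -T j i k l
  skew : ∀ i j k l, T i j k l = -T i j l k
  bianchi : ∀ i j k l, T i j k l + T j k i l + T k i j l = 0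
  ricci : ∀ j k, ∑ i, T i j k i = 0

namespace IsWeylTensor

section General

variable {ι : Type*} [Fintype ι] {T : ι → ι → ι → ι → ℝ}

theorem self_left (h : IsWeylTensor T) (i k l : ι) : T i i k l = 0 := by
  linarith [h.antisymm i i k l]

theorem self_right (h : IsWeylTensor T) (i j k : ι) : T i j k k = 0 := by
  linarith [h.skew i j k k]

theorem pair_symm (h : IsWeylTensor T) (i j k l : ι) : T i j k l = T k l i j :=
  curvature_pair_symm h.antisymm h.skew h.bianchi i j k l

theorem flip (h : IsWeylTensor T) (i j k l : ι) : T i j k l = T j i l k := by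
  rw [h.antisymm, h.skew, neg_neg]

theorem reverse (h : IsWeylTensor T) (i j k l : ι) : T i j k l = T l k j i := by
  rw [h.pair_symm, h.flip]

theorem ricci' (h : IsWeylTensor T) (j k : ι) : ∑ i, T j i k i = 0 := by
  rw [← neg_eq_zero, ← h.ricci j k, ← Finset.sum_neg_distrib]
  exact Finset.sum_congr rfl fun i _ => (h.antisymm i j k i).symm

/-- If `N m n` are the components of the second covariant derivative of a Ricci-flat curvature
tensor `T`, then the rough Laplacian of `T` is a quadratic expression in `T`. -/
theorem sum_hess_eq {N : ι → ι → ι → ι → ι → ι → ℝ} (hN : ∀ m n, IsWeylTensor (N m n))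
    (hB : ∀ m i j k w l, N m i j k w l + N m j k i w l + N m k i j w l = 0) (a b c d : ι) :
    ∑ m, N m m a b c d = ∑ m, (N a m b m c d - N m a b m c d)
      + ∑ m, (N b m m a c d - N m b m a c d) := by
  -- Contracted second Bianchi identity: the divergence of `R` is a combination of derivatives of
  -- the Ricci tensor, hence zero. The right-hand side of the claim is therefore a sum of
  -- commutators up to vanishing terms.
  have key : ∀ x z, ∑ m, N x m z m c d = 0 := by
    intro x z
    have h1 : ∀ m, N x m z m c d = -N x c d m z m - N x d m c z m := fun m => by
      rw [(hN x m).pair_symm]; linarith [hB x m c d z m]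
    simp only [h1, Finset.sum_sub_distrib, Finset.sum_neg_distrib]
    rw [(hN x c).ricci' d z, (hN x d).ricci c z]
    simp
  have h2 : ∑ m, N b m m a c d = 0 := by
    rw [← neg_eq_zero, ← Finset.sum_neg_distrib, ← key b a]
    exact Finset.sum_congr rfl fun m _ => ((hN b m).antisymm a m c d).symm
  have h3 : ∀ m, N m m a b c d = -N m a b m c d - N m b m a c d := fun m => by
    linarith [hB m m a b c d]
  simp only [h3, Finset.sum_sub_distrib, Finset.sum_neg_distrib, key a b, h2]
  ring

end General

section DimFour

variable {T : Fin 4 → Fin 4 → Fin 4 → Fin 4 → ℝ}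

/-- The quadratic reaction term at a critical plane spanned by the first two basis vectors. -/
theorem sum_hess_critical (h : IsWeylTensor T)
    {N : Fin 4 → Fin 4 → Fin 4 → Fin 4 → Fin 4 → Fin 4 → ℝ} (hN : ∀ m n, IsWeylTensor (N m n))
    (hB : ∀ m i j k w l, N m i j k w l + N m j k i w l + N m k i j w l = 0)
    (hR : ∀ m n i j k l, N m n i j k l - N n m i j k l =
      -∑ p, (T m n i p * T p j k l + T m n j p * T i p k l + T m n k p * T i j p l
        + T m n l p * T i j k p))
    (h2 : T 2 1 1 0 = 0) (h3 : T 3 1 1 0 = 0) (h2' : T 0 2 1 0 = 0) (h3' : T 0 3 1 0 = 0) :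
    ∑ m, N m m 0 1 1 0 = -3 * (T 0 1 1 0 ^ 2 + T 0 1 2 3 ^ 2)
      + 4 * ((T 0 2 2 0 + T 0 1 1 0 / 2) ^ 2 + T 0 2 2 1 ^ 2 + T 0 2 3 0 ^ 2
        + (T 0 2 3 1 + T 0 1 2 3 / 2) ^ 2) := by
  rw [sum_hess_eq hN hB]
  simp only [hR]
  have a10 := h.antisymm 1 0
  have a20 := h.antisymm 2 0
  have a30 := h.antisymm 3 0
  have a21 := h.antisymm 2 1
  have a31 := h.antisymm 3 1
  have a32 := h.antisymm 3 2
  have b10 := fun i j => h.skew i j 1 0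
  have b20 := fun i j => h.skew i j 2 0
  have b30 := fun i j => h.skew i j 3 0
  have b21 := fun i j => h.skew i j 2 1
  have b31 := fun i j => h.skew i j 3 1
  have b32 := fun i j => h.skew i j 3 2
  have r00 := h.ricci 0 0
  have r01 := h.ricci 0 1
  have r02 := h.ricci 0 2
  have r03 := h.ricci 0 3
  have r11 := h.ricci 1 1
  have r12 := h.ricci 1 2
  have r13 := h.ricci 1 3
  have r22 := h.ricci 2 2
  have r23 := h.ricci 2 3
  have r33 := h.ricci 3 3
  have bi := h.bianchi 0 1 2 3
  have p1 := h.pair_symm 0 2 0 1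
  have p2 := h.pair_symm 0 3 0 1
  have p3 := h.pair_symm 1 2 0 1
  have p4 := h.pair_symm 1 3 0 1
  have p5 := h.pair_symm 2 3 0 1
  have p6 := h.pair_symm 0 3 0 2
  have p7 := h.pair_symm 1 2 0 2
  have p8 := h.pair_symm 1 3 0 2
  have p9 := h.pair_symm 2 3 0 2
  have p10 := h.pair_symm 1 2 0 3
  have p11 := h.pair_symm 1 3 0 3
  have p12 := h.pair_symm 2 3 0 3
  have p13 := h.pair_symm 1 3 1 2
  have p14 := h.pair_symm 2 3 1 2
  have p15 := h.pair_symm 2 3 1 3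
  have c1 := b10 0 1
  have c2 := b20 0 2
  have c3 := b21 0 2
  have c4 := b30 0 2
  have c5 := b31 0 2
  simp only [Fin.sum_univ_four, h.self_left, h.self_right, a10, a20, a30, a21, a31, a32, b10, b20,
    b30, b21, b31, b32] at *
  have q1 : T 0 1 0 2 = 0 := by linarith
  have q2 : T 0 1 0 3 = 0 := by linarith
  have q3 : T 0 1 1 2 = 0 := by linarith
  have q4 : T 0 1 1 3 = 0 := by linarith
  have q5 : T 0 2 2 3 = 0 := by linarith
  have q6 : T 0 3 2 3 = 0 := by linarith
  have q7 : T 1 2 2 3 = 0 := by linarith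
  have q8 : T 1 3 2 3 = 0 := by linarith
  have s1 : T 0 2 0 1 = 0 := by linarith
  have s2 : T 0 3 0 1 = 0 := by linarith
  have s3 : T 1 2 0 1 = 0 := by linarith
  have s4 : T 1 3 0 1 = 0 := by linarith
  have t2 : T 1 3 1 3 = T 0 2 0 2 := by linarith
  have t3 : T 0 3 0 3 = -T 0 1 0 1 - T 0 2 0 2 := by linarith
  have t4 : T 1 2 1 2 = -T 0 1 0 1 - T 0 2 0 2 := by linarith
  have t5 : T 0 3 1 3 = -T 0 2 1 2 := by linarith
  have t6 : T 1 2 1 3 = -T 0 2 0 3 := by linarith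
  have t7 : T 0 3 1 2 = T 0 2 1 3 - T 0 1 2 3 := by linarith
  simp only [p5, p6, p7, p8, p10, p11, p13, q1, q2, q3, q4, q5, q6, q7, q8, s1, s2, s3, s4,
    t2, t3, t4, t5, t6, t7]
  ring

/-- Put `S = κ + T 0 1 1 0 / 2`. By Ricci-flatness the right side of `q1` is `S² - (T 0 2 2 0 + T 0
1 1 0 / 2)²`, and `q2` is four times `(T 0 2 3 1 + T 0 1 2 3 / 2)² ≤ S² - T 0 2 3 0²`. So the four
squares in `hQ` add up to at most `2 S²`, and `T 0 1 2 3 ^ 2` may be dropped. -/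
theorem sq_le_of_pinched (h : IsWeylTensor T) {κ : ℝ}
    (hQ : 0 ≤ -3 * (T 0 1 1 0 ^ 2 + T 0 1 2 3 ^ 2)
      + 4 * ((T 0 2 2 0 + T 0 1 1 0 / 2) ^ 2 + T 0 2 2 1 ^ 2 + T 0 2 3 0 ^ 2
        + (T 0 2 3 1 + T 0 1 2 3 / 2) ^ 2))
    (q1 : T 0 2 2 1 ^ 2 ≤ (κ - T 0 2 2 0) * (κ - T 1 2 2 1))
    (q2 : (T 0 2 2 1 + T 0 2 3 1 + T 0 3 2 1 + T 0 3 3 1) ^ 2 ≤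
      (2 * κ - (T 0 2 2 0 + 2 * T 0 2 3 0 + T 0 3 3 0)) *
      (2 * κ - (T 1 2 2 1 + 2 * T 1 2 3 1 + T 1 3 3 1))) :
    3 * T 0 1 1 0 ^ 2 ≤ 8 * (κ + T 0 1 1 0 / 2) ^ 2 := by
  have r0 := h.ricci 0 0
  have r1 := h.ricci 1 1
  have r2 := h.ricci 2 2
  have r3 := h.ricci 3 3
  have r01 := h.ricci 0 1
  have r23 := h.ricci 2 3
  have bi := h.bianchi 0 1 2 3
  simp only [Fin.sum_univ_four, h.self_left] at r0 r1 r2 r3 r01 r23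
  have f1 := h.flip 1 0 0 1
  have f2 := h.flip 2 0 0 2
  have f3 := h.flip 3 0 0 3
  have f4 := h.flip 2 1 1 2
  have f5 := h.flip 3 1 1 3
  have f6 := h.flip 3 2 2 3
  have f7 := h.flip 2 0 1 2
  have f8 := h.flip 3 0 1 3
  have t1 : T 1 2 2 1 = -T 0 1 1 0 - T 0 2 2 0 := by linarith
  have t2 : T 1 3 3 1 = T 0 2 2 0 := by linarith
  have t3 : T 0 3 3 0 = -T 0 1 1 0 - T 0 2 2 0 := by linarith
  have t4 : T 0 3 3 1 = -T 0 2 2 1 := by linarith [h.self_right 1 0 1, h.self_right 0 0 1]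
  have t5 : T 1 2 3 1 = -T 0 2 3 0 := by linarith [h.self_right 3 2 3]
  have t6 : T 0 3 2 1 = T 0 2 3 1 + T 0 1 2 3 := by
    linarith [h.flip 1 2 0 3, h.antisymm 1 2 0 3, h.pair_symm 1 2 0 3, h.antisymm 2 0 1 3,
      h.skew 0 2 1 3, h.skew 0 3 1 2]
  rw [t1] at q1 q2
  rw [t2, t3, t4, t5, t6] at q2
  nlinarith [sq_nonneg (T 0 1 2 3)]

end DimFour

end IsWeylTensor

/-! ### Second-order conditions at a minimum and first variation of the sectional curvature. -/

namespace LocalMetric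

section MaximumPrinciple

variable {E : Type*} [NormedAddCommGroup E] [NormedSpace ℝ E]

/-- At a local minimum the second derivative is positive semidefinite. -/
theorem fderiv_fderiv_nonneg_of_isLocalMin {f : E → ℝ} {y : E} (hf : ContDiffAt ℝ ∞ f y)
    (hmin : IsLocalMin f y) (m : E) : 0 ≤ fderiv ℝ (fderiv ℝ f) y m m := by
  set L : ℝ → E := fun t => y + t • m with hL
  have hL0 : L 0 = y := by simp [hL]
  have hLd : ∀ t, HasDerivAt L m t := fun t => by
    simpa [hL] using ((hasDerivAt_id t).smul_const m).const_add y
  have hLc : Filter.Tendsto L (nhds 0) (nhds y) := by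
    have := (hLd 0).continuousAt.tendsto
    rwa [hL0] at this
  have h1 : deriv (fun t => f (L t)) =ᶠ[nhds 0] fun t => fderiv ℝ f (L t) m := by
    have := (hf.of_le (m := 1) (by simp)).eventually (by simp)
    filter_upwards [hLc.eventually this] with t ht
    exact ((ht.differentiableAt (by simp)).hasFDerivAt.comp_hasDerivAt t (hLd t)).deriv
  have hd : DifferentiableAt ℝ (fderiv ℝ f) y :=
    (hf.fderiv_right (m := ∞) (by simp)).differentiableAt (by simp)
  have h2 : HasDerivAt (fun t => fderiv ℝ f (L t) m) (fderiv ℝ (fderiv ℝ f) y m m) 0 := by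
    have hd' : HasFDerivAt (fderiv ℝ f) (fderiv ℝ (fderiv ℝ f) y) (L 0) := by
      rw [hL0]; exact hd.hasFDerivAt
    simpa using (hd'.comp_hasDerivAt (0 : ℝ) (hLd 0)).clm_apply (hasDerivAt_const (0 : ℝ) m)
  have h3 : deriv (deriv fun t => f (L t)) 0 = fderiv ℝ (fderiv ℝ f) y m m := by
    rw [h1.deriv_eq, h2.deriv]
  have hmin' : IsLocalMin (fun t => f (L t)) 0 := by
    have : ∀ᶠ t in nhds (0 : ℝ), f y ≤ f (L t) := hLc.eventually hmin
    simpa [IsLocalMin, IsMinFilter, hL0] using this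
  by_contra! hlt
  have hc : ContinuousAt (fun t => f (L t)) 0 := by
    refine ContinuousAt.comp (g := f) ?_ (hLd 0).continuousAt
    rw [hL0]; exact hf.continuousAt
  -- A negative second derivative would make the local minimum along the line also a local maximum,
  -- so the function would be locally constant and its second derivative zero.
  have hmax : IsLocalMax (fun t => f (L t)) 0 :=
    isLocalMax_of_deriv_deriv_neg (by rw [h3]; exact hlt) hmin'.deriv_eq_zero hc
  have hconst : (fun t => f (L t)) =ᶠ[nhds 0] fun _ => f (L 0) := by
    filter_upwards [hmin', hmax] with t h h' using le_antisymm h' h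
  rw [hconst.deriv.deriv_eq] at h3
  simp at h3
  linarith

theorem fderiv_fderiv_mul_of_fderiv_eq_zero {a b : E → ℝ} {y : E} (ha : ContDiffAt ℝ ∞ a y)
    (hb : ContDiffAt ℝ ∞ b y) (hb' : fderiv ℝ b y = 0) (m n : E) :
    fderiv ℝ (fderiv ℝ fun x => a x * b x) y m n =
      a y * fderiv ℝ (fderiv ℝ b) y m n + fderiv ℝ (fderiv ℝ a) y m n * b y := by
  have hL : ContDiffAt ℝ ∞ (fun x => ContinuousLinearMap.mul ℝ ℝ (a x)) y :=
    contDiffAt_const.clm_apply ha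
  have := fderiv_fderiv_clm_apply hL hb m n
  rw [fderiv_fderiv_clm_apply contDiffAt_const ha] at this
  simpa [hb'] using this

theorem eq_zero_of_forall_linear_add_quadratic_nonneg {b c : ℝ}
    (h : ∀ t : ℝ, 0 ≤ b * t + c * t ^ 2) : b = 0 := by
  have hc : 0 < |c| + 1 := by positivity
  -- This `t` is opposite in sign to `b`, and the linear term outweighs the quadratic one whatever
  -- the sign of `c`.
  have h1 := h (-b / (|c| + 1))
  have h2 : b * (-b / (|c| + 1)) + c * (-b / (|c| + 1)) ^ 2 =
      b ^ 2 / (|c| + 1) ^ 2 * (c - (|c| + 1)) := by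
    field_simp; ring
  rw [h2] at h1
  have h3 : c - (|c| + 1) ≤ -1 := by linarith [le_abs_self c]
  have h4 : 0 ≤ b ^ 2 / (|c| + 1) ^ 2 := by positivity
  have h5 : b ^ 2 / (|c| + 1) ^ 2 = 0 := by nlinarith
  have h6 : b ^ 2 = 0 := by
    rcases div_eq_zero_iff.1 h5 with h | h
    · exact h
    · exact absurd h (by positivity)
  exact pow_eq_zero_iff (two_ne_zero) |>.1 h6

/-- A positive semidefinite binary quadratic form has nonnegative discriminant. -/
theorem sq_le_mul_of_forall_quadratic_nonneg {a b c : ℝ}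
    (h : ∀ x y : ℝ, 0 ≤ a * x ^ 2 + 2 * b * x * y + c * y ^ 2) : b ^ 2 ≤ a * c := by
  have ha := h 1 0
  have hc := h 0 1
  -- At this vector the form takes the value `a * (a * c - b ^ 2)`.
  have h1 := h b (-a)
  norm_num at ha hc
  rcases ha.eq_or_lt with ha | ha
  · subst ha
    have : b = 0 := eq_zero_of_forall_linear_add_quadratic_nonneg (b := b) (c := c) fun t => by
      have := h (1 / 2) t
      linarith
    simp [this]
  · nlinarith

namespace IsMetricOn

variable [FiniteDimensional ℝ E] {G : E → E →L[ℝ] E →L[ℝ] ℝ} {U : Set E} {y : E}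

theorem curvature_add_middle (u v v' w : E) :
    curvature G y (v + v') w u = curvature G y v w u + curvature G y v' w u := by
  simp [curvature_apply]; abel

theorem curvature_smul_middle (c : ℝ) (u v w : E) :
    curvature G y (c • v) w u = c • curvature G y v w u := by
  simp [curvature_apply, smul_sub, smul_add]

theorem curvature_add_right (u v w w' : E) :
    curvature G y v (w + w') u = curvature G y v w u + curvature G y v w' u := by
  simp [curvature_apply]; abel

theorem curvature_smul_right (c : ℝ) (u v w : E) :
    curvature G y v (c • w) u = c • curvature G y v w u := by
  simp [curvature_apply, smul_sub, smul_add]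

theorem curvature_pair_symm (hG : IsMetricOn G U) (hy : y ∈ U) (u v w z : E) :
    G y (curvature G y v w u) z = G y (curvature G y z u w) v :=
  _root_.curvature_pair_symm (T := fun u v w z => G y (curvature G y v w u) z)
    (fun u v w z => by rw [curvature_antisymm]; simp)
    (fun u v w z => hG.curvature_skew hy u v w z)
    (fun u v w z => by
      have := congrArg (fun a => G y a z) (hG.curvature_bianchi hy u v w)
      simpa using this) u v w z

/-- First variation of the sectional curvature at a minimal plane. -/
theorem curvature_inner_of_min (hG : IsMetricOn G U) (hy : y ∈ U) {k : ℝ} {a b : E}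
    (ha : G y a a = 1) (hb : G y b b = 1) (hab : G y a b = 0)
    (hk : G y (curvature G y b b a) a = k)
    (hmin : ∀ u v, k * (G y u u * G y v v - G y u v ^ 2) ≤ G y (curvature G y v v u) u) (w : E) :
    G y (curvature G y b b w) a = k * G y w a := by
  -- The plane is varied through `a + t • w` and `b`. The constant terms in `t` agree by `hk`, so
  -- the linear coefficient must vanish.
  have h := eq_zero_of_forall_linear_add_quadratic_nonneg
    (b := 2 * (G y (curvature G y b b w) a - k * G y w a))
    (c := G y (curvature G y b b w) w - k * (G y w w - G y w b ^ 2)) fun t => by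
      have h := hmin (a + t • w) b
      have h1 : G y (curvature G y b b a) w = G y (curvature G y b b w) a := by
        rw [hG.curvature_pair_symm hy, curvature_antisymm, map_neg, neg_apply,
          ← hG.curvature_skew hy]
      have h2 := hG.symm y hy a w
      simp only [map_add, map_smul, add_apply, smul_apply, smul_eq_mul, ha, hb, hab, hk,
        h1, h2] at h
      linarith
  linarith

end IsMetricOn

end MaximumPrinciple

/-! ### The maximum principle at a minimal plane in dimension four. -/

section FourDim

variable {E : Type*} [NormedAddCommGroup E] [NormedSpace ℝ E] [FiniteDimensional ℝ E]
  {G : E → E →L[ℝ] E →L[ℝ] ℝ} {U : Set E} {y : E}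

namespace IsMetricOn

/-- The maximum principle for the sectional curvature at a minimal plane. -/
theorem curvatureHess_nonneg_of_min (hG : IsMetricOn G U) (hy : y ∈ U)
    (hΓ : christoffel G y = 0) {k : ℝ} {a b : E}
    (ha : G y a a = 1) (hb : G y b b = 1) (hab : G y a b = 0)
    (hk : G y (curvature G y b b a) a = k)
    (hmin : ∀ x ∈ U, ∀ u v,
      k * (G x u u * G x v v - G x u v ^ 2) ≤ G x (curvature G x v v u) u) (m : E) :
    0 ≤ G y (curvatureHess G y m m a b b) a := by
  have c0 := ((hG.contDiffAt hy).clm_apply (hG.contDiffAt_curvature hy a b b)).clm_apply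
    (contDiffAt_const (c := a))
  have c1 : ∀ u v, ContDiffAt ℝ ∞ (fun x => G x u v) y := fun u v =>
    ((hG.contDiffAt hy).clm_apply contDiffAt_const).clm_apply contDiffAt_const
  have d1 : ∀ u v, fderiv ℝ (fun x => G x u v) y = 0 := fun u v => by
    ext w
    rw [fderiv_clm_apply₂_const (hG.differentiableAt hy), hG.fderiv_eq_zero hy hΓ]
    simp
  have d2 : ∀ u v, fderiv ℝ (fderiv ℝ fun x => G x u v) y m m =
      G y (fderiv ℝ (christoffel G) y m m u) v + G y u (fderiv ℝ (christoffel G) y m m v) :=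
    fun u v => by
      rw [fderiv_fderiv_clm_apply_const ((hG.contDiffAt hy).clm_apply contDiffAt_const),
        fderiv_fderiv_clm_apply_const (hG.contDiffAt hy),
        hG.fderiv_fderiv_apply_of_christoffel_eq_zero hy hΓ]
  have cA := ((c1 a a).mul (c1 b b)).sub ((c1 a b).mul (c1 a b))
  -- Subtracting `k` times the squared area allows `a` and `b` to stay constant, although they are
  -- not orthonormal away from `y`.
  have hloc : IsLocalMin (fun x => G x (curvature G x b b a) a
      - k • (G x a a * G x b b - G x a b * G x a b)) y := by
    filter_upwards [hG.isOpen.mem_nhds hy] with x hx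
    have := hmin x hx a b
    simp only [ha, hb, hab, hk, smul_eq_mul]
    linarith
  have h := fderiv_fderiv_nonneg_of_isLocalMin (c0.sub (cA.const_smul k)) hloc m
  rw [fderiv_fderiv_sub c0 (cA.const_smul k), fderiv_fderiv_const_smul cA,
    fderiv_fderiv_sub ((c1 a a).mul (c1 b b)) ((c1 a b).mul (c1 a b)),
    fderiv_fderiv_mul_of_fderiv_eq_zero (c1 a a) (c1 b b) (d1 b b),
    fderiv_fderiv_mul_of_fderiv_eq_zero (c1 a b) (c1 a b) (d1 a b),
    hG.fderiv_fderiv_curvature_inner hy hΓ, d2, d2, ha, hb, hab] at h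
  set H : E →L[ℝ] E := fderiv ℝ (christoffel G) y m m with hH
  have hba : G y b a = 0 := by rw [hG.symm y hy, hab]
  have hk' : G y (curvature G y a a b) b = k := by
    rw [hG.curvature_pair_symm hy, hk]
  -- The coordinate Hessian differs from the covariant one by curvature terms with `H a` or `H b` in
  -- one slot. The first variation evaluates them as multiples of `k`, and they cancel against the
  -- Hessian of the area.
  have f1 := hG.curvature_inner_of_min hy ha hb hab hk (hmin y hy) (H a)
  have f2 := hG.curvature_inner_of_min hy hb ha hba hk' (hmin y hy) (H b)
  have g1 : G y (curvature G y b b a) (H a) = G y (curvature G y b b (H a)) a := by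
    rw [hG.curvature_pair_symm hy, curvature_antisymm, map_neg, neg_apply,
      ← hG.curvature_skew hy]
  have g2 : G y (curvature G y (H b) b a) a = G y (curvature G y a a (H b)) b := by
    rw [curvature_antisymm, map_neg, neg_apply, ← hG.curvature_skew hy]
  have g3 : G y (curvature G y b (H b) a) a = G y (curvature G y a a (H b)) b := by
    rw [hG.curvature_pair_symm hy]
  have s1 := hG.symm y hy a (H a)
  have s2 := hG.symm y hy b (H b)
  simp only [curvatureHess, map_add, map_sub, add_apply, sub_apply, ← hH]
  simp only [smul_eq_mul] at h
  rw [g2, g3, f1, f2]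
  rw [g1, f1, s1, s2] at h
  linarith

/-- The pinching inequality at a plane of minimal sectional curvature of a Ricci-flat metric in
dimension four, when the Christoffel symbols vanish at the base point. -/
theorem sq_le_of_pinched_of_christoffel_eq_zero (hG : IsMetricOn G U) (hy : y ∈ U)
    (hΓ : christoffel G y = 0)
    (hRic : ∀ x ∈ U, ∀ v w, LinearMap.trace ℝ E (curvature G x v w) = 0)
    (b : Module.Basis (Fin 4) ℝ E) (hb : ∀ i j, G y (b i) (b j) = if i = j then 1 else 0)
    {k κ : ℝ} (hk : G y (curvature G y (b 1) (b 1) (b 0)) (b 0) = k)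
    (hmin : ∀ x ∈ U, ∀ u v,
      k * (G x u u * G x v v - G x u v ^ 2) ≤ G x (curvature G x v v u) u)
    (hmax : ∀ u v, G y (curvature G y v v u) u ≤ κ * (G y u u * G y v v - G y u v ^ 2)) :
    3 * k ^ 2 ≤ 8 * (κ + k / 2) ^ 2 := by
  have repr_eq : ∀ x i, b.repr x i = G y x (b i) := fun x i => by
    conv_rhs => rw [← b.sum_repr x]
    simp only [map_sum, map_smul, sum_apply, smul_apply, smul_eq_mul, hb, mul_ite, mul_one,
      mul_zero, Finset.sum_ite_eq', Finset.mem_univ, if_true]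
  set T : Fin 4 → Fin 4 → Fin 4 → Fin 4 → ℝ := fun i j k l =>
    G y (curvature G y (b j) (b k) (b i)) (b l) with hT
  set N : Fin 4 → Fin 4 → Fin 4 → Fin 4 → Fin 4 → Fin 4 → ℝ := fun m n i j k l =>
    G y (curvatureHess G y (b m) (b n) (b i) (b j) (b k)) (b l) with hN
  have hTW : IsWeylTensor T := by
    refine ⟨fun i j k l => ?_, fun i j k l => hG.curvature_skew hy _ _ _ _, fun i j k l => ?_,
      fun j k => ?_⟩
    · simp only [hT]; rw [curvature_antisymm]; simp
    · simpa using congrArg (fun a => G y a (b l)) (hG.curvature_bianchi hy (b i) (b j) (b k))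
    · have := hRic y hy (b j) (b k)
      rw [LinearMap.trace_eq_matrix_trace ℝ b] at this
      simpa [Matrix.trace, LinearMap.toMatrix_apply, repr_eq] using this
  have hNW : ∀ m n, IsWeylTensor (N m n) := by
    intro m n
    refine ⟨fun i j k l => ?_, fun i j k l => hG.curvatureHess_skew hy hΓ _ _ _ _ _ _,
      fun i j k l => ?_, fun j k => ?_⟩
    · simp only [hN]; rw [hG.curvatureHess_antisymm hy hΓ]; simp
    · simpa using congrArg (fun a => G y a (b l))
        (hG.curvatureHess_bianchi₁ hy (b m) (b n) (b i) (b j) (b k))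
    · simpa [repr_eq] using hG.sum_curvatureHess_eq_zero hy b hRic (b m) (b n) (b j) (b k)
  have hB : ∀ m i j k w l, N m i j k w l + N m j k i w l + N m k i j w l = 0 := by
    intro m i j k w l
    simpa using congrArg (fun a => G y a (b l))
      (hG.curvatureHess_bianchi₂ hy hΓ (b m) (b i) (b j) (b k) (b w))
  have hlin : ∀ (f : E →ₗ[ℝ] ℝ) x, f x = ∑ p, G y x (b p) * f (b p) := fun f x => by
    conv_lhs => rw [← b.sum_repr x]
    simp only [repr_eq, map_sum, map_smul, smul_eq_mul]
  have hR : ∀ m n i j k l, N m n i j k l - N n m i j k l =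
      -∑ p, (T m n i p * T p j k l + T m n j p * T i p k l + T m n k p * T i j p l
        + T m n l p * T i j k p) := by
    intro m n i j k l
    have h := congrArg (fun a => G y a (b l))
      (hG.curvatureHess_sub_symm hy hΓ (b m) (b n) (b i) (b j) (b k))
    simp only [map_sub, sub_apply] at h
    have e1 : G y (curvature G y (b n) (curvature G y (b j) (b k) (b i)) (b m)) (b l) =
        -∑ p, T m n l p * T i j k p := by
      rw [hG.curvature_skew hy]
      refine congrArg Neg.neg ((hlin (G y (curvature G y (b n) (b l) (b m))).toLinearMap
        (curvature G y (b j) (b k) (b i))).trans (Finset.sum_congr rfl fun p _ => mul_comm _ _))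
    have e2 : G y (curvature G y (b j) (b k) (curvature G y (b n) (b i) (b m))) (b l) =
        ∑ p, T m n i p * T p j k l :=
      hlin (((G y).flip (b l)).toLinearMap ∘ₗ curvature G y (b j) (b k)) _
    have e3 : G y (curvature G y (curvature G y (b n) (b j) (b m)) (b k) (b i)) (b l) =
        ∑ p, T m n j p * T i p k l := by
      rw [curvature_antisymm, map_neg, neg_apply]
      refine (congrArg Neg.neg (hlin (((G y).flip (b l)).toLinearMap ∘ₗ
        curvature G y (b i) (b k)) _)).trans ?_
      rw [← Finset.sum_neg_distrib]
      refine Finset.sum_congr rfl fun p _ => ?_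
      rw [hTW.antisymm i p k l, mul_neg]
      rfl
    have e4 : G y (curvature G y (b j) (curvature G y (b n) (b k) (b m)) (b i)) (b l) =
        ∑ p, T m n k p * T i j p l := by
      rw [hG.curvature_pair_symm hy]
      refine (hlin (((G y).flip (b j)).toLinearMap ∘ₗ curvature G y (b l) (b i)) _).trans ?_
      refine Finset.sum_congr rfl fun p _ => ?_
      rw [hTW.pair_symm i j p l]
      rfl
    simp only [hN]
    rw [h, e1, e2, e3, e4]
    simp only [Finset.sum_add_distrib]
    ring
  have b01 : G y (b 0) (b 1) = 0 := by simp [hb]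
  have b10 : G y (b 1) (b 0) = 0 := by simp [hb]
  have b00 : G y (b 0) (b 0) = 1 := by simp [hb]
  have b11 : G y (b 1) (b 1) = 1 := by simp [hb]
  have hk' : G y (curvature G y (b 0) (b 0) (b 1)) (b 1) = k := by
    rw [hG.curvature_pair_symm hy, hk]
  have crit : ∀ w, G y (curvature G y (b 1) (b 1) w) (b 0) = k * G y w (b 0) :=
    hG.curvature_inner_of_min hy b00 b11 b01 hk (hmin y hy)
  have crit' : ∀ w, G y (curvature G y (b 0) (b 0) w) (b 1) = k * G y w (b 1) :=
    hG.curvature_inner_of_min hy b11 b00 b10 hk' (hmin y hy)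
  -- The four side conditions are the first variation of the plane when `b 0`, respectively `b 1`,
  -- is moved towards `b 2` and `b 3`.
  have hsum := hTW.sum_hess_critical hNW hB hR
    (by simp only [hT]; rw [crit, hb]; simp) (by simp only [hT]; rw [crit, hb]; simp)
    (by rw [hTW.antisymm, hTW.skew, neg_neg]; simp only [hT]; rw [crit', hb]; simp)
    (by rw [hTW.antisymm, hTW.skew, neg_neg]; simp only [hT]; rw [crit', hb]; simp)
  have hpos : 0 ≤ ∑ m, N m m 0 1 1 0 := Finset.sum_nonneg fun m _ =>
    hG.curvatureHess_nonneg_of_min hy hΓ b00 b11 b01 hk hmin (b m)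
  have hT0 : T 0 1 1 0 = k := hk
  have rev := hTW.reverse
  -- Discriminant of the upper curvature bound for the pairs `x • b 0 + z • b 1`, `b 2`; the next
  -- inequality uses `b 2 + b 3`, whose squared length 2 accounts for the factors `2 * κ`.
  have q1 : T 0 2 2 1 ^ 2 ≤ (κ - T 0 2 2 0) * (κ - T 1 2 2 1) := by
    have := sq_le_mul_of_forall_quadratic_nonneg (a := κ - T 0 2 2 0) (b := -T 0 2 2 1)
      (c := κ - T 1 2 2 1) fun x z => by
        have h := hmax (x • b 0 + z • b 1) (b 2)
        have e := rev 1 2 2 0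
        simp only [hT] at e ⊢
        simp [hb] at h
        rw [e] at h
        linarith
    linarith
  have q2 : (T 0 2 2 1 + T 0 2 3 1 + T 0 3 2 1 + T 0 3 3 1) ^ 2 ≤
      (2 * κ - (T 0 2 2 0 + 2 * T 0 2 3 0 + T 0 3 3 0)) *
      (2 * κ - (T 1 2 2 1 + 2 * T 1 2 3 1 + T 1 3 3 1)) := by
    have := sq_le_mul_of_forall_quadratic_nonneg
      (a := 2 * κ - (T 0 2 2 0 + 2 * T 0 2 3 0 + T 0 3 3 0))
      (b := -(T 0 2 2 1 + T 0 2 3 1 + T 0 3 2 1 + T 0 3 3 1))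
      (c := 2 * κ - (T 1 2 2 1 + 2 * T 1 2 3 1 + T 1 3 3 1)) fun x z => by
        have h := hmax (x • b 0 + z • b 1) (b 2 + b 3)
        have e1 := rev 1 2 2 0
        have e2 := rev 1 2 3 0
        have e3 := rev 1 3 2 0
        have e4 := rev 1 3 3 0
        have e5 := rev 0 3 2 0
        have e6 := rev 1 3 2 1
        simp only [hT] at e1 e2 e3 e4 e5 e6 ⊢
        simp [hb, curvature_add_middle, curvature_add_right] at h
        rw [e1, e2, e3, e4, e5, e6] at h
        linarith
    linarith
  rw [hsum] at hpos
  exact hT0 ▸ hTW.sq_le_of_pinched hpos q1 q2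

end IsMetricOn

end FourDim

/-! ### Reduction to coordinates with vanishing Christoffel symbols. -/

variable {E : Type*} [NormedAddCommGroup E] [NormedSpace ℝ E] [FiniteDimensional ℝ E]
  {G G' : E → E →L[ℝ] E →L[ℝ] ℝ} {U V : Set E} {ψ : E → E} {x y : E}

namespace IsPullbackOn

theorem apply_curvature (h : IsPullbackOn G' G ψ V U) (hx : x ∈ V) (u v w z : E) :
    G' x (curvature G' x v w u) z = G (ψ x) (curvature G (ψ x) (fderiv ℝ ψ x v) (fderiv ℝ ψ x w)
      (fderiv ℝ ψ x u)) (fderiv ℝ ψ x z) := by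
  rw [h.apply_eq x hx, h.fderiv_curvature_apply hx]

theorem trace_curvature (h : IsPullbackOn G' G ψ V U) (hx : x ∈ V) (v w : E) :
    LinearMap.trace ℝ E (curvature G' x v w) =
      LinearMap.trace ℝ E (curvature G (ψ x) (fderiv ℝ ψ x v) (fderiv ℝ ψ x w)) := by
  let e : E ≃ₗ[ℝ] E := LinearEquiv.ofInjectiveEndo (fderiv ℝ ψ x).toLinearMap (h.injective x hx)
  rw [← LinearMap.trace_conj' (curvature G' x v w) e]
  congr 1
  ext u
  rw [LinearEquiv.conj_apply_apply]
  refine (h.fderiv_curvature_apply hx _ v w).trans ?_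
  congr 1
  exact e.apply_symm_apply u

end IsPullbackOn

/-- Every metric is, near a given point, the source of a pullback under a local diffeomorphism with
prescribed `1`-jet `x ↦ y + x` for which the Christoffel symbols at the origin vanish. -/
theorem IsMetricOn.exists_isPullbackOn (hG : IsMetricOn G U) (hy : y ∈ U) :
    ∃ (G' : E → E →L[ℝ] E →L[ℝ] ℝ) (ψ : E → E) (V : Set E), IsPullbackOn G' G ψ V U ∧
      0 ∈ V ∧ ψ 0 = y ∧ fderiv ℝ ψ 0 = ContinuousLinearMap.id ℝ E ∧ christoffel G' 0 = 0 := by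
  set Γ := christoffel G y with hΓ
  -- The quadratic term gives `ψ` the second derivative `-Γ` at the origin, which cancels the
  -- Christoffel symbols in the transformation law.
  set ψ : E → E := fun x => y + x - (1 / 2 : ℝ) • Γ x x with hψ
  have hfd : ∀ x, HasFDerivAt ψ (ContinuousLinearMap.id ℝ E - Γ x) x := by
    intro x
    have h := ((hasFDerivAt_id x).const_add y).sub
      (((Γ.hasFDerivAt (x := x)).clm_apply (hasFDerivAt_id x)).const_smul (1 / 2 : ℝ))
    refine h.congr_fderiv ?_
    ext u
    have := hG.christoffel_symm hy u x
    rw [← hΓ] at this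
    simp [this, ← two_smul ℝ, smul_smul]
  have hfd' : fderiv ℝ ψ = fun x => ContinuousLinearMap.id ℝ E - Γ x :=
    funext fun x => (hfd x).fderiv
  have hfd2 : fderiv ℝ (fderiv ℝ ψ) 0 = -Γ := by
    rw [hfd', fderiv_const_sub]
    simp
  have hsmooth : ContDiff ℝ ∞ ψ := by
    have : ContDiff ℝ ∞ fun x => Γ x x := Γ.contDiff.clm_apply contDiff_id
    exact (contDiff_const.add contDiff_id).sub (contDiff_const.smul this)
  set V : Set E := ψ ⁻¹' U ∩ fderiv ℝ ψ ⁻¹' Set.range ((↑) : (E ≃L[ℝ] E) → E →L[ℝ] E) with hV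
  have hVo : IsOpen V := by
    refine (hG.isOpen.preimage hsmooth.continuous).inter
      (ContinuousLinearEquiv.isOpen.preimage ?_)
    rw [hfd']
    fun_prop
  have hψ0 : ψ 0 = y := by simp [hψ]
  have h0 : fderiv ℝ ψ 0 = ContinuousLinearMap.id ℝ E := by rw [hfd']; simp
  have h0V : (0 : E) ∈ V :=
    ⟨by simpa [hψ0] using hy, ⟨ContinuousLinearEquiv.refl ℝ E, by rw [h0]; rfl⟩⟩
  have hP : IsPullbackOn (fun x => (G (ψ x)).bilinearComp (fderiv ℝ ψ x) (fderiv ℝ ψ x)) G ψ V U :=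
    { isMetricOn := hG
      isOpen := hVo
      contDiffOn := hsmooth.contDiffOn
      mapsTo := fun x hx => hx.1
      injective := fun x hx => by
        obtain ⟨e, he⟩ := hx.2
        rw [← he]
        exact e.injective
      apply_eq := fun x _ u v => rfl }
  refine ⟨_, ψ, V, hP, h0V, hψ0, h0, ?_⟩
  ext u v
  have := hP.fderiv_christoffel_apply h0V u v
  rw [hfd2, hψ0, h0, ← hΓ] at this
  simpa using this

namespace IsMetricOn

/-- The pinching inequality at a plane of minimal sectional curvature of a Ricci-flat metric in
dimension four. -/
theorem sq_le_of_pinched (hG : IsMetricOn G U) (hy : y ∈ U)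
    (hRic : ∀ x ∈ U, ∀ v w, LinearMap.trace ℝ E (curvature G x v w) = 0)
    (b : Module.Basis (Fin 4) ℝ E) (hb : ∀ i j, G y (b i) (b j) = if i = j then 1 else 0)
    {k κ : ℝ} (hk : G y (curvature G y (b 1) (b 1) (b 0)) (b 0) = k)
    (hmin : ∀ x ∈ U, ∀ u v,
      k * (G x u u * G x v v - G x u v ^ 2) ≤ G x (curvature G x v v u) u)
    (hmax : ∀ u v, G y (curvature G y v v u) u ≤ κ * (G y u u * G y v v - G y u v ^ 2)) :
    3 * k ^ 2 ≤ 8 * (κ + k / 2) ^ 2 := by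
  obtain ⟨G', ψ, V, hP, h0, hψ0, hid, hΓ⟩ := hG.exists_isPullbackOn hy
  have hG'0 : ∀ u v, G' 0 u v = G y u v := fun u v => by
    rw [hP.apply_eq 0 h0, hψ0, hid]; rfl
  have hc0 : ∀ u v w z, G' 0 (curvature G' 0 v w u) z = G y (curvature G y v w u) z := by
    intro u v w z
    rw [hP.apply_curvature h0, hψ0, hid]; rfl
  refine hP.isMetricOn_pullback.sq_le_of_pinched_of_christoffel_eq_zero h0 hΓ ?_ b ?_ ?_ ?_ ?_
  · intro x hx v w
    rw [hP.trace_curvature hx, hRic _ (hP.mapsTo hx)]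
  · simpa only [hG'0] using hb
  · rw [hc0, hk]
  · intro x hx u v
    rw [hP.apply_curvature hx, hP.apply_eq x hx, hP.apply_eq x hx, hP.apply_eq x hx]
    exact hmin _ (hP.mapsTo hx) _ _
  · intro u v
    rw [hc0, hG'0, hG'0, hG'0]
    exact hmax u v

end IsMetricOn

end LocalMetric

/-! ### The metric and its curvature in charts. -/

namespace Riemannian

variable {E : Type*} [NormedAddCommGroup E] [NormedSpace ℝ E]
  {M : Type*} [TopologicalSpace M] [ChartedSpace E M] [IsManifold 𝓘(ℝ, E) ∞ M]

theorem mfderiv_extChartAt_symm_mfderiv_extChartAt {p q : M}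
    (hq : q ∈ (extChartAt 𝓘(ℝ, E) p).source) (v : E) :
    (mfderiv 𝓘(ℝ, E) 𝓘(ℝ, E) (extChartAt 𝓘(ℝ, E) p).symm (extChartAt 𝓘(ℝ, E) p q) : E → E)
      ((mfderiv 𝓘(ℝ, E) 𝓘(ℝ, E) (extChartAt 𝓘(ℝ, E) p) q : E → E) v) = v := by
  have : IsManifold 𝓘(ℝ, E) 1 M := IsManifold.of_le (n := ∞) (by simp)
  have h := mfderivWithin_extChartAt_symm_comp_mfderiv_extChartAt' (I := 𝓘(ℝ, E)) (x := p) hq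
  rw [ModelWithCorners.range_eq_univ, mfderivWithin_univ] at h
  exact DFunLike.congr_fun h v

theorem mfderiv_extChartAt_mfderiv_extChartAt_symm {p : M} {y : E}
    (hy : y ∈ (extChartAt 𝓘(ℝ, E) p).target) (v : E) :
    (mfderiv 𝓘(ℝ, E) 𝓘(ℝ, E) (extChartAt 𝓘(ℝ, E) p) ((extChartAt 𝓘(ℝ, E) p).symm y) : E → E)
      ((mfderiv 𝓘(ℝ, E) 𝓘(ℝ, E) (extChartAt 𝓘(ℝ, E) p).symm y : E → E) v) = v := by
  have : IsManifold 𝓘(ℝ, E) 1 M := IsManifold.of_le (n := ∞) (by simp)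
  have h := mfderiv_extChartAt_comp_mfderivWithin_extChartAt_symm (I := 𝓘(ℝ, E)) (x := p) hy
  rw [ModelWithCorners.range_eq_univ, mfderivWithin_univ] at h
  exact DFunLike.congr_fun h v

theorem metricInChart_apply (g : Metric E M) (p : M) (y u v : E) :
    metricInChart g p y u v = g.inner ((extChartAt 𝓘(ℝ, E) p).symm y)
      (mfderiv 𝓘(ℝ, E) 𝓘(ℝ, E) (extChartAt 𝓘(ℝ, E) p).symm y u)
      (mfderiv 𝓘(ℝ, E) 𝓘(ℝ, E) (extChartAt 𝓘(ℝ, E) p).symm y v) := rfl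

theorem contMDiffOn_mfderiv_extChartAt_symm (p : M) (v : E) :
    ContMDiffOn 𝓘(ℝ, E) (𝓘(ℝ, E).prod 𝓘(ℝ, E)) ∞
      (fun y => (⟨(extChartAt 𝓘(ℝ, E) p).symm y,
        mfderiv 𝓘(ℝ, E) 𝓘(ℝ, E) (extChartAt 𝓘(ℝ, E) p).symm y v⟩ : TangentBundle 𝓘(ℝ, E) M))
      (extChartAt 𝓘(ℝ, E) p).target := by
  have ho : IsOpen (extChartAt 𝓘(ℝ, E) p).target := isOpen_extChartAt_target p
  have h1 := (contMDiffOn_extChartAt_symm (I := 𝓘(ℝ, E)) (n := ∞) p).contMDiffOn_tangentMapWithin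
    (m := ∞) (by simp) ho.uniqueMDiffOn
  have h2 : ContMDiff 𝓘(ℝ, E) (𝓘(ℝ, E).prod 𝓘(ℝ, E)) ∞
      (fun y : E => (⟨y, v⟩ : TangentBundle 𝓘(ℝ, E) E)) :=
    contMDiff_vectorSpace_iff_contDiff.2 contDiff_const
  have h3 := h1.comp (h2.contMDiffOn (s := (extChartAt 𝓘(ℝ, E) p).target)) fun y hy => hy
  refine h3.congr fun y hy => ?_
  simp only [Function.comp, tangentMapWithin, mfderivWithin_of_isOpen ho hy]

theorem isMetricOn_metricInChart [FiniteDimensional ℝ E] (g : Metric E M) (p : M) :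
    LocalMetric.IsMetricOn (metricInChart g p) (extChartAt 𝓘(ℝ, E) p).target where
  isOpen := isOpen_extChartAt_target p
  contDiffOn := by
    rw [contDiffOn_clm_apply]
    intro u
    rw [contDiffOn_clm_apply]
    intro v
    rw [← contMDiffOn_iff_contDiffOn]
    have hg := g.contMDiff.comp_contMDiffOn (contMDiffOn_extChartAt_symm (I := 𝓘(ℝ, E)) (n := ∞) p)
    have h := ContMDiffOn.clm_bundle_apply₂ (F₁ := E) (F₂ := E) (F₃ := ℝ)
      (E₃ := fun _ : M => ℝ) (b := (extChartAt 𝓘(ℝ, E) p).symm)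
      hg (contMDiffOn_mfderiv_extChartAt_symm p u) (contMDiffOn_mfderiv_extChartAt_symm p v)
    intro y hy
    exact (Bundle.contMDiffWithinAt_totalSpace.1 (h y hy)).2
  symm y _ u v := by rw [metricInChart_apply, metricInChart_apply, g.symm]
  pos y hy u hu := by
    rw [metricInChart_apply]
    refine g.pos _ _ fun h0 => hu ?_
    have := mfderiv_extChartAt_mfderiv_extChartAt_symm hy u
    rw [← this]
    exact (congrArg _ h0).trans (map_zero _)

theorem metricInChart_mfderiv {p q : M} (hq : q ∈ (extChartAt 𝓘(ℝ, E) p).source) {y : E}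
    (hy : y = extChartAt 𝓘(ℝ, E) p q) (g : Metric E M) (u v : E) :
    metricInChart g p y ((mfderiv 𝓘(ℝ, E) 𝓘(ℝ, E) (extChartAt 𝓘(ℝ, E) p) q : E → E) u)
      ((mfderiv 𝓘(ℝ, E) 𝓘(ℝ, E) (extChartAt 𝓘(ℝ, E) p) q : E → E) v) =
      g.inner q (u : TangentSpace 𝓘(ℝ, E) q) (v : TangentSpace 𝓘(ℝ, E) q) := by
  subst hy
  -- The point obtained by going through the chart and back equals `q` only propositionally, so the
  -- base point is generalised before it is replaced.
  have key : ∀ (q' : M) (_ : q' = q) (a b : E), g.inner q' (a : TangentSpace 𝓘(ℝ, E) q')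
      (b : TangentSpace 𝓘(ℝ, E) q') = g.inner q (a : TangentSpace 𝓘(ℝ, E) q)
      (b : TangentSpace 𝓘(ℝ, E) q) := by
    rintro _ rfl a b; rfl
  refine (key _ ((extChartAt 𝓘(ℝ, E) p).left_inv hq) _ _).trans ?_
  congr 1
  · congr 1
    exact mfderiv_extChartAt_symm_mfderiv_extChartAt hq u
  · exact mfderiv_extChartAt_symm_mfderiv_extChartAt hq v

/-- The metric in the chart around `q` is the pullback of the metric in the chart around `p` under
the transition map. -/
theorem isPullbackOn_metricInChart [FiniteDimensional ℝ E] (g : Metric E M) (p q : M) :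
    LocalMetric.IsPullbackOn (metricInChart g q) (metricInChart g p)
      (fun y => extChartAt 𝓘(ℝ, E) p ((extChartAt 𝓘(ℝ, E) q).symm y))
      ((extChartAt 𝓘(ℝ, E) q).target ∩
        (extChartAt 𝓘(ℝ, E) q).symm ⁻¹' (extChartAt 𝓘(ℝ, E) p).source)
      (extChartAt 𝓘(ℝ, E) p).target := by
  have hfd : ∀ y ∈ (extChartAt 𝓘(ℝ, E) q).target ∩
      (extChartAt 𝓘(ℝ, E) q).symm ⁻¹' (extChartAt 𝓘(ℝ, E) p).source, ∀ u : E,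
      fderiv ℝ (fun y => extChartAt 𝓘(ℝ, E) p ((extChartAt 𝓘(ℝ, E) q).symm y)) y u =
      (mfderiv 𝓘(ℝ, E) 𝓘(ℝ, E) (extChartAt 𝓘(ℝ, E) p) ((extChartAt 𝓘(ℝ, E) q).symm y) : E → E)
        ((mfderiv 𝓘(ℝ, E) 𝓘(ℝ, E) (extChartAt 𝓘(ℝ, E) q).symm y : E → E) u) := by
    intro y hy u
    have h1 : MDifferentiableAt 𝓘(ℝ, E) 𝓘(ℝ, E) (extChartAt 𝓘(ℝ, E) p)
        ((extChartAt 𝓘(ℝ, E) q).symm y) :=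
      ((contMDiffOn_extChartAt (I := 𝓘(ℝ, E)) (n := ∞) (x := p)).contMDiffAt
        ((chartAt E p).open_source.mem_nhds (by simpa using hy.2))).mdifferentiableAt (by simp)
    have h2 : MDifferentiableAt 𝓘(ℝ, E) 𝓘(ℝ, E) (extChartAt 𝓘(ℝ, E) q).symm y :=
      ((contMDiffOn_extChartAt_symm (I := 𝓘(ℝ, E)) (n := ∞) q).contMDiffAt
        ((isOpen_extChartAt_target q).mem_nhds hy.1)).mdifferentiableAt (by simp)
    have h3 := mfderiv_comp y h1 h2
    rw [mfderiv_eq_fderiv] at h3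
    exact DFunLike.congr_fun h3 u
  refine ⟨isMetricOn_metricInChart g p, ?_, ?_, ?_, ?_, ?_⟩
  · exact (continuousOn_extChartAt_symm q).isOpen_inter_preimage (isOpen_extChartAt_target q)
      (isOpen_extChartAt_source p)
  · rw [← contMDiffOn_iff_contDiffOn]
    refine (contMDiffOn_extChartAt (I := 𝓘(ℝ, E)) (n := ∞) (x := p)).comp
      ((contMDiffOn_extChartAt_symm (I := 𝓘(ℝ, E)) (n := ∞) q).mono Set.inter_subset_left) ?_
    intro y hy
    simpa using hy.2
  · exact fun y hy => (extChartAt 𝓘(ℝ, E) p).map_source hy.2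
  · intro y hy
    rw [injective_iff_map_eq_zero]
    intro u hu
    rw [hfd y hy u] at hu
    have h1 := mfderiv_extChartAt_symm_mfderiv_extChartAt hy.2
      ((mfderiv 𝓘(ℝ, E) 𝓘(ℝ, E) (extChartAt 𝓘(ℝ, E) q).symm y : E → E) u)
    rw [hu] at h1
    have h2 := mfderiv_extChartAt_mfderiv_extChartAt_symm hy.1 u
    rw [← h1] at h2
    rw [← h2]
    exact (congrArg _ (map_zero _)).trans (map_zero _)
  · intro y hy u v
    rw [hfd y hy u, hfd y hy v]
    exact (metricInChart_mfderiv hy.2 rfl g _ _).symm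

variable [FiniteDimensional ℝ E]

/-- The differential of the chart around `p` intertwines the curvature of `g` with the curvature of
the metric in that chart, at every point of the chart domain. -/
theorem exists_linearEquiv_chart (g : Metric E M) {p q : M}
    (hq : q ∈ (extChartAt 𝓘(ℝ, E) p).source) :
    ∃ L : TangentSpace 𝓘(ℝ, E) q ≃ₗ[ℝ] E,
      (∀ u v, metricInChart g p (extChartAt 𝓘(ℝ, E) p q) (L u) (L v) = g.inner q u v) ∧
      ∀ u v w, L (curvature g q v w u) =
        LocalMetric.curvature (metricInChart g p) (extChartAt 𝓘(ℝ, E) p q) (L v) (L w) (L u) := by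
  have : IsManifold 𝓘(ℝ, E) 1 M := IsManifold.of_le (n := ∞) (by simp)
  let D : E →L[ℝ] E := mfderiv 𝓘(ℝ, E) 𝓘(ℝ, E) (extChartAt 𝓘(ℝ, E) q) q
  let B : E →L[ℝ] E := mfderiv 𝓘(ℝ, E) 𝓘(ℝ, E) (extChartAt 𝓘(ℝ, E) p) q
  let A : E →L[ℝ] E :=
    mfderiv 𝓘(ℝ, E) 𝓘(ℝ, E) (extChartAt 𝓘(ℝ, E) p).symm (extChartAt 𝓘(ℝ, E) p q)
  have hAB : Function.LeftInverse A B := mfderiv_extChartAt_symm_mfderiv_extChartAt hq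
  have hB : Function.Injective B.toLinearMap := hAB.injective
  let L : E ≃ₗ[ℝ] E := LinearEquiv.ofInjectiveEndo B.toLinearMap hB
  have hD : D.IsInvertible :=
    isInvertible_mfderiv_extChartAt (I := 𝓘(ℝ, E)) (mem_extChartAt_source q)
  have hP := isPullbackOn_metricInChart g p q
  set ψ : E → E := fun y => extChartAt 𝓘(ℝ, E) p ((extChartAt 𝓘(ℝ, E) q).symm y) with hψ
  have hqs : (extChartAt 𝓘(ℝ, E) q).symm (extChartAt 𝓘(ℝ, E) q q) = q := by simp
  have hmem : extChartAt 𝓘(ℝ, E) q q ∈ (extChartAt 𝓘(ℝ, E) q).target ∩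
      (extChartAt 𝓘(ℝ, E) q).symm ⁻¹' (extChartAt 𝓘(ℝ, E) p).source :=
    ⟨mem_extChartAt_target q, by simpa using hq⟩
  have hψq : ψ (extChartAt 𝓘(ℝ, E) q q) = extChartAt 𝓘(ℝ, E) p q := by simp only [hψ, hqs]
  -- Chain rule for the chart around `p`, which near `q` is the transition map `ψ` after the chart
  -- around `q`. The curvature at `q` is defined in the chart around `q`, whence the comparison.
  have hfd : ∀ u, fderiv ℝ ψ (extChartAt 𝓘(ℝ, E) q q) (D u) = B u := by
    intro u
    have h1 : (extChartAt 𝓘(ℝ, E) p : M → E) =ᶠ[nhds q] ψ ∘ extChartAt 𝓘(ℝ, E) q := by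
      filter_upwards [extChartAt_source_mem_nhds (I := 𝓘(ℝ, E)) q] with x hx
      simp only [hψ, Function.comp, (extChartAt 𝓘(ℝ, E) q).left_inv hx]
    have h2 : MDifferentiableAt 𝓘(ℝ, E) 𝓘(ℝ, E) ψ (extChartAt 𝓘(ℝ, E) q q) :=
      (hP.differentiableAt hmem).mdifferentiableAt
    have h3 : MDifferentiableAt 𝓘(ℝ, E) 𝓘(ℝ, E) (extChartAt 𝓘(ℝ, E) q) q :=
      mdifferentiableAt_extChartAt (mem_chart_source E q)
    have h4 := mfderiv_comp q h2 h3
    rw [mfderiv_eq_fderiv] at h4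
    have h5 : B = mfderiv 𝓘(ℝ, E) 𝓘(ℝ, E) (ψ ∘ extChartAt 𝓘(ℝ, E) q) q := h1.mfderiv_eq
    rw [h5]
    exact (DFunLike.congr_fun h4 u).symm
  have key : ∀ u v w : E, B (D.inverse (LocalMetric.curvature (metricInChart g q)
      (extChartAt 𝓘(ℝ, E) q q) (D v) (D w) (D u))) =
      LocalMetric.curvature (metricInChart g p) (extChartAt 𝓘(ℝ, E) p q) (B v) (B w) (B u) := by
    intro u v w
    rw [← hfd, hD.self_apply_inverse, hP.fderiv_curvature_apply hmem, hfd, hfd, hfd, hψq]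
  exact ⟨L, fun u v => metricInChart_mfderiv hq rfl g u v, fun u v w => key u v w⟩

end Riemannian

/-! ### Sectional curvature as a function of planes. -/

namespace LocalMetric

section Planes

variable {E : Type*} [NormedAddCommGroup E] [NormedSpace ℝ E]

/-- Gram-Schmidt orthonormalization of a pair of vectors. -/
theorem exists_orthonormal_pair (B : E →L[ℝ] E →L[ℝ] ℝ)
    (pos : ∀ u, u ≠ 0 → 0 < B u u) {u v : E} (h : LinearIndependent ℝ ![u, v]) :
    ∃ (u' v' : E) (a b c : ℝ), u = a • u' ∧ v = b • u' + c • v' ∧ B u' u' = 1 ∧ B v' v' = 1 ∧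
      B u' v' = 0 ∧ a ≠ 0 ∧ c ≠ 0 := by
  rw [LinearIndependent.pair_iff] at h
  have normalize : ∀ u, u ≠ 0 → √(B u u) ≠ 0 ∧ B ((√(B u u))⁻¹ • u) ((√(B u u))⁻¹ • u) = 1 := by
    intro u hu
    have h0 := pos u hu
    have h1 : √(B u u) ≠ 0 := (Real.sqrt_pos.2 h0).ne'
    refine ⟨h1, ?_⟩
    simp only [map_smul, smul_apply, smul_eq_mul]
    rw [← mul_assoc, ← mul_inv, Real.mul_self_sqrt h0.le, inv_mul_cancel₀ h0.ne']
  have hu : u ≠ 0 := by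
    rintro rfl
    have := (h 1 0 (by simp)).1
    norm_num at this
  obtain ⟨ha, hu1⟩ := normalize u hu
  set a := √(B u u)
  set u' := a⁻¹ • u with hu'
  set b := B u' v with hb
  have hw : v - b • u' ≠ 0 := by
    intro h0
    have := (h (-(b * a⁻¹)) 1 (by rw [← h0, hu', smul_smul]; module)).2
    norm_num at this
  obtain ⟨hc, hw1⟩ := normalize _ hw
  set c := √(B (v - b • u') (v - b • u'))
  refine ⟨u', c⁻¹ • (v - b • u'), a, b, c, ?_, ?_, hu1, hw1, ?_, ha, hc⟩
  · rw [hu', smul_inv_smul₀ ha]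
  · rw [smul_inv_smul₀ hc]; abel
  · simp [hu1, ← hb]

theorem exists_basis_of_orthonormal_pair [FiniteDimensional ℝ E] (hE : Module.finrank ℝ E = 4)
    (B : E →L[ℝ] E →L[ℝ] ℝ) (symm : ∀ u v, B u v = B v u)
    (pos : ∀ u, u ≠ 0 → 0 < B u u) {u v : E} (hu : B u u = 1) (hv : B v v = 1)
    (huv : B u v = 0) :
    ∃ b : Module.Basis (Fin 4) ℝ E, (∀ i j, B (b i) (b j) = if i = j then 1 else 0) ∧
      b 0 = u ∧ b 1 = v := by
  -- `V` carries no norm, so `B` can be installed as its inner product; on `E` this would clash with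
  -- the given norm.
  have aux : ∀ {V : Type _} [AddCommGroup V] [Module ℝ V] [FiniteDimensional ℝ V]
      (_ : Module.finrank ℝ V = 4) (B : V →ₗ[ℝ] V →ₗ[ℝ] ℝ) (_ : ∀ u v, B u v = B v u)
      (_ : ∀ u, u ≠ 0 → 0 < B u u) {u v : V} (_ : B u u = 1) (_ : B v v = 1) (_ : B u v = 0),
      ∃ b : Module.Basis (Fin 4) ℝ V, (∀ i j, B (b i) (b j) = if i = j then 1 else 0) ∧
      b 0 = u ∧ b 1 = v := by
    intro V _ _ _ hV B symm pos u v hu hv huv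
    let core : InnerProductSpace.Core ℝ V :=
      { inner := fun x y => B x y
        conj_inner_symm := fun x y => symm y x
        re_inner_nonneg := fun x => by
          by_cases hx : x = 0
          · simp [hx]
          · exact (pos x hx).le
        add_left := fun x y z => by simp
        smul_left := fun x y r => by simp
        definite := fun x hx => by
          by_contra h0
          exact (pos x h0).ne' hx }
    let _ : NormedAddCommGroup V := core.toNormedAddCommGroup
    let _ : InnerProductSpace ℝ V := InnerProductSpace.ofCore core.toCore
    have hin : ∀ x y : V, inner ℝ x y = B x y := fun x y => rfl
    -- The zeros are placeholders: only the entries with index `0` and `1` are prescribed.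
    have horth : Orthonormal ℝ (Set.domRestrict ({0, 1} : Set (Fin 4)) ![u, v, 0, 0]) := by
      rw [orthonormal_iff_ite]
      rintro ⟨i, hi⟩ ⟨j, hj⟩
      have hvu : B v u = 0 := by rw [symm, huv]
      rcases hi with rfl | rfl <;> rcases hj with rfl | rfl
      · exact hu.trans (if_pos rfl).symm
      · exact huv.trans (if_neg fun h => absurd (congrArg Subtype.val h) (by decide)).symm
      · exact hvu.trans (if_neg fun h => absurd (congrArg Subtype.val h) (by decide)).symm
      · exact hv.trans (if_pos rfl).symm
    obtain ⟨b, hb⟩ := horth.exists_orthonormalBasis_extension_of_card_eq (by simp [hV])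
    refine ⟨b.toBasis, fun i j => ?_, ?_, ?_⟩
    · have := orthonormal_iff_ite.1 b.orthonormal i j
      simpa [hin] using this
    · simpa using hb 0 (by simp)
    · simpa using hb 1 (by simp)
  exact aux hE (LinearMap.mk₂ ℝ (fun u v => B u v) (by simp) (by simp) (by simp) (by simp))
    symm pos hu hv huv

namespace IsMetricOn

variable {G : E → E →L[ℝ] E →L[ℝ] ℝ} {U : Set E} {y : E}

/-- The curvature form scales by the same factor `a ^ 2 * c ^ 2`, so the quotient is unchanged.
Triangular changes of basis suffice, as these are what Gram-Schmidt produces. -/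
theorem area_combination (hG : IsMetricOn G U) (hy : y ∈ U) (u v : E) (a b c : ℝ) :
    G y (a • u) (a • u) * G y (b • u + c • v) (b • u + c • v) - G y (a • u) (b • u + c • v) ^ 2 =
      a ^ 2 * c ^ 2 * (G y u u * G y v v - G y u v ^ 2) := by
  simp only [map_add, map_smul, add_apply, smul_apply, smul_eq_mul, hG.symm y hy v u]
  ring

theorem area_pos (hG : IsMetricOn G U) (hy : y ∈ U) {u v : E}
    (h : LinearIndependent ℝ ![u, v]) : 0 < G y u u * G y v v - G y u v ^ 2 := by
  obtain ⟨u', v', a, b, c, rfl, rfl, hu, hv, huv, ha, hc⟩ :=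
    exists_orthonormal_pair (G y) (hG.pos y hy) h
  rw [hG.area_combination hy, hu, hv, huv]
  have : 0 < a ^ 2 * c ^ 2 := by positivity
  linarith

variable [FiniteDimensional ℝ E]

theorem curvature_self (v w : E) : curvature G y v w v = 0 := by
  simp [curvature_apply]

theorem curvature_inner_self (hG : IsMetricOn G U) (hy : y ∈ U) (u v w : E) :
    G y (curvature G y v w u) w = 0 := by
  linarith [hG.curvature_skew hy u v w w]

theorem curvature_inner_combination (hG : IsMetricOn G U) (hy : y ∈ U) (u v : E) (a b c : ℝ) :
    G y (curvature G y (b • u + c • v) (b • u + c • v) (a • u)) (a • u) =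
      a ^ 2 * c ^ 2 * G y (curvature G y v v u) u := by
  simp only [curvature_add_middle, curvature_add_right, curvature_smul_middle,
    curvature_smul_right, map_add, map_smul, curvature_self, add_apply, smul_apply,
    hG.curvature_inner_self hy, smul_eq_mul, map_zero, smul_zero, zero_apply]
  ring

/-- Serves to extend curvature bounds on planes to arbitrary pairs of vectors, as the quadratic
variations require. -/
theorem curvature_inner_and_area_eq_zero {u v : E}
    (h : ¬LinearIndependent ℝ ![u, v]) :
    G y (curvature G y v v u) u = 0 ∧ G y u u * G y v v - G y u v ^ 2 = 0 := by
  by_cases hu : u = 0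
  · simp [hu]
  · rw [LinearIndependent.pair_iff' hu] at h
    push Not at h
    obtain ⟨a, rfl⟩ := h
    refine ⟨?_, ?_⟩
    · rw [curvature_smul_middle, curvature_self]; simp
    · simp; ring

/-- A metric whose sectional curvatures vanish at a point is flat there. -/
theorem curvature_eq_zero_of_forall_curvature_inner (hG : IsMetricOn G U) (hy : y ∈ U)
    (h : ∀ u v, G y (curvature G y v v u) u = 0) (u v w : E) : curvature G y v w u = 0 := by
  -- Polarisation in `u`, then in `v`, makes `R(u, v) w` alternating in all three arguments. The
  -- three terms of the Bianchi identity are then equal.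
  have h1 : ∀ u v z, G y (curvature G y v v u) z = 0 := by
    intro u v z
    have e := h (u + z) v
    have e' : G y (curvature G y v v z) u = G y (curvature G y v v u) z := by
      rw [hG.curvature_pair_symm hy, curvature_antisymm, map_neg, neg_apply,
        ← hG.curvature_skew hy]
    simp only [map_add, add_apply, h, e'] at e
    linarith
  have h2 : ∀ u v w, curvature G y v w u = -curvature G y w v u := by
    intro u v w
    refine hG.ext_of_apply hy fun z => ?_
    have e := h1 u (v + w) z
    simp only [curvature_add_middle, curvature_add_right, map_add, add_apply, h1] at e
    rw [map_neg, neg_apply]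
    linarith
  have h3 := hG.curvature_bianchi hy u v w
  have e1 : curvature G y w u v = curvature G y v w u := by
    rw [h2, curvature_antisymm, neg_neg]
  have e2 : curvature G y u v w = curvature G y v w u := by
    rw [curvature_antisymm, ← h2 u v w]
  rw [e1, e2] at h3
  have h4 : (3 : ℝ) • curvature G y v w u = 0 := by rw [← h3]; module
  exact (smul_eq_zero.1 h4).resolve_left (by norm_num)

end IsMetricOn

end Planes

/-! ### Extrema of the sectional curvature over compact sets. -/

section Compactness

variable {E : Type*} [NormedAddCommGroup E] [InnerProductSpace ℝ E]
  {G : E → E →L[ℝ] E →L[ℝ] ℝ} {U : Set E}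

namespace IsMetricOn

variable (E) in
/-- Orthonormal pairs of vectors. -/
def orthonormalPairs : Set (E × E) :=
  {x | inner ℝ x.1 x.1 = (1 : ℝ) ∧ inner ℝ x.2 x.2 = (1 : ℝ) ∧ inner ℝ x.1 x.2 = (0 : ℝ)}

theorem linearIndependent_of_mem_orthonormalPairs {x : E × E} (hx : x ∈ orthonormalPairs E) :
    LinearIndependent ℝ ![x.1, x.2] := by
  obtain ⟨h1, h2, h3⟩ := hx
  rw [LinearIndependent.pair_iff]
  intro s t h
  have e1 := congrArg (fun z => inner ℝ x.1 z) h
  have e2 := congrArg (fun z => inner ℝ z x.2) h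
  simp only [inner_add_right, inner_add_left, inner_smul_right, inner_smul_left, h1, h2, h3,
    inner_zero_right, inner_zero_left] at e1 e2
  simpa using And.intro e1 e2

variable [FiniteDimensional ℝ E]

theorem isCompact_orthonormalPairs : IsCompact (orthonormalPairs E) := by
  refine ((isCompact_sphere (0 : E) 1).prod (isCompact_sphere (0 : E) 1)).of_isClosed_subset ?_ ?_
  · refine (isClosed_eq (by fun_prop) continuous_const).inter
      ((isClosed_eq (by fun_prop) continuous_const).inter
        (isClosed_eq (by fun_prop) continuous_const))
  · rintro ⟨u, v⟩ ⟨h1, h2, -⟩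
    simp only [real_inner_self_eq_norm_sq] at h1 h2
    simp only [Set.mem_prod, mem_sphere_zero_iff_norm]
    refine ⟨?_, ?_⟩ <;> nlinarith [norm_nonneg u, norm_nonneg v]

/-- Orthonormality refers to the fixed inner product of `E`, not to `G`. The parameter space of
planes is thus one compact set, the same at every point, at the price of keeping the area
denominator. -/
theorem continuousOn_sectional (hG : IsMetricOn G U) :
    ContinuousOn (fun x : E × E × E => G x.1 (curvature G x.1 x.2.2 x.2.2 x.2.1) x.2.1 /
      (G x.1 x.2.1 x.2.1 * G x.1 x.2.2 x.2.2 - G x.1 x.2.1 x.2.2 ^ 2))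
      (U ×ˢ orthonormalPairs E) := by
  have hfst : ContinuousOn (fun x : E × E × E => x.1) (U ×ˢ orthonormalPairs E) :=
    continuousOn_fst
  have hu : ContinuousOn (fun x : E × E × E => x.2.1) (U ×ˢ orthonormalPairs E) := by fun_prop
  have hv : ContinuousOn (fun x : E × E × E => x.2.2) (U ×ˢ orthonormalPairs E) := by fun_prop
  have hmaps : Set.MapsTo (fun x : E × E × E => x.1) (U ×ˢ orthonormalPairs E) U :=
    fun x hx => hx.1
  have cG : ContinuousOn (fun x : E × E × E => G x.1) (U ×ˢ orthonormalPairs E) :=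
    hG.contDiffOn.continuousOn.comp hfst hmaps
  have cΓ : ContinuousOn (fun x : E × E × E => christoffel G x.1) (U ×ˢ orthonormalPairs E) :=
    hG.contDiffOn_christoffel.continuousOn.comp hfst hmaps
  have cD : ContinuousOn (fun x : E × E × E => fderiv ℝ (christoffel G) x.1)
      (U ×ˢ orthonormalPairs E) :=
    (hG.contDiffOn_christoffel.fderiv_of_isOpen (m := ∞) hG.isOpen
      (by simp)).continuousOn.comp hfst hmaps
  have cR : ContinuousOn (fun x : E × E × E => curvature G x.1 x.2.2 x.2.2 x.2.1)
      (U ×ˢ orthonormalPairs E) := by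
    simp only [curvature_apply]
    exact (((((cD.clm_apply hu).clm_apply hv).clm_apply hv).sub
      (((cD.clm_apply hv).clm_apply hu).clm_apply hv)).add
      ((cΓ.clm_apply hu).clm_apply ((cΓ.clm_apply hv).clm_apply hv))).sub
      ((cΓ.clm_apply hv).clm_apply ((cΓ.clm_apply hu).clm_apply hv))
  refine ((cG.clm_apply cR).clm_apply hu).div ((((cG.clm_apply hu).clm_apply hu).mul
    ((cG.clm_apply hv).clm_apply hv)).sub (((cG.clm_apply hu).clm_apply hv).pow 2)) ?_
  intro x hx
  exact (hG.area_pos hx.1 (linearIndependent_of_mem_orthonormalPairs hx.2)).ne'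

/-- Every plane has an orthonormal basis. -/
theorem exists_orthonormalPairs (hG : IsMetricOn G U) {y : E} (hy : y ∈ U) {u v : E}
    (h : LinearIndependent ℝ ![u, v]) : ∃ x ∈ orthonormalPairs E,
      G y (curvature G y v v u) u / (G y u u * G y v v - G y u v ^ 2) =
      G y (curvature G y x.2 x.2 x.1) x.1 / (G y x.1 x.1 * G y x.2 x.2 - G y x.1 x.2 ^ 2) := by
  obtain ⟨u', v', a, b, c, rfl, rfl, hu, hv, huv, ha, hc⟩ :=
    exists_orthonormal_pair (innerSL ℝ) (fun u hu => real_inner_self_pos.2 hu) h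
  refine ⟨(u', v'), ⟨hu, hv, huv⟩, ?_⟩
  rw [hG.area_combination hy, hG.curvature_inner_combination hy,
    mul_div_mul_left _ _ (by positivity)]

theorem exists_forall_sectional_le (hG : IsMetricOn G U) {C : Set E} (hC : IsCompact C)
    (hCU : C ⊆ U) : ∃ κ : ℝ, ∀ y ∈ C, ∀ u v, LinearIndependent ℝ ![u, v] →
      G y (curvature G y v v u) u / (G y u u * G y v v - G y u v ^ 2) ≤ κ := by
  obtain ⟨κ, hκ⟩ := (hC.prod isCompact_orthonormalPairs).bddAbove_image
    (hG.continuousOn_sectional.mono (Set.prod_mono_left hCU))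
  refine ⟨κ, fun y hy u v h => ?_⟩
  obtain ⟨x, hx, he⟩ := hG.exists_orthonormalPairs (hCU hy) h
  rw [he]
  exact hκ ⟨(y, x), ⟨hy, hx⟩, rfl⟩

theorem exists_forall_le_sectional (hG : IsMetricOn G U) {C : Set E} (hC : IsCompact C)
    (hCU : C ⊆ U) (hCne : C.Nonempty) (hE : 2 ≤ Module.finrank ℝ E) :
    ∃ y₀ ∈ C, ∃ u₀ v₀, LinearIndependent ℝ ![u₀, v₀] ∧
      ∀ y ∈ C, ∀ u v, LinearIndependent ℝ ![u, v] →
      G y₀ (curvature G y₀ v₀ v₀ u₀) u₀ / (G y₀ u₀ u₀ * G y₀ v₀ v₀ - G y₀ u₀ v₀ ^ 2) ≤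
      G y (curvature G y v v u) u / (G y u u * G y v v - G y u v ^ 2) := by
  have hne : (orthonormalPairs E).Nonempty := by
    let b := stdOrthonormalBasis ℝ E
    have hb := orthonormal_iff_ite.1 b.orthonormal
    refine ⟨(b ⟨0, by omega⟩, b ⟨1, by omega⟩), ?_, ?_, ?_⟩ <;> simp [hb]
  obtain ⟨⟨y₀, x₀⟩, ⟨hy₀, hx₀⟩, hmin⟩ := (hC.prod isCompact_orthonormalPairs).exists_isMinOn
    (hCne.prod hne) (hG.continuousOn_sectional.mono (Set.prod_mono_left hCU))
  refine ⟨y₀, hy₀, x₀.1, x₀.2, linearIndependent_of_mem_orthonormalPairs hx₀,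
    fun y hy u v h => ?_⟩
  obtain ⟨x, hx, he⟩ := hG.exists_orthonormalPairs (hCU hy) h
  rw [he]
  exact hmin (show (y, x) ∈ C ×ˢ orthonormalPairs E from ⟨hy, hx⟩)

end IsMetricOn

end Compactness

end LocalMetric

/-! ### Sectional curvatures on the compact manifold. -/

namespace Riemannian

open LocalMetric

theorem linearIndependent_pair_map_iff {V W : Type*} [AddCommGroup V] [Module ℝ V]
    [AddCommGroup W] [Module ℝ W] (L : V ≃ₗ[ℝ] W) (u v : V) :
    LinearIndependent ℝ ![L u, L v] ↔ LinearIndependent ℝ ![u, v] := by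
  simp only [LinearIndependent.pair_iff, ← map_smul, ← map_add, map_eq_zero_iff L L.injective]

section Charts

variable {E : Type*} [NormedAddCommGroup E] [NormedSpace ℝ E] [FiniteDimensional ℝ E]
  {M : Type*} [TopologicalSpace M] [ChartedSpace E M] [IsManifold 𝓘(ℝ, E) ∞ M]

/-- The sectional curvatures at a point of a chart domain, computed in that chart. -/
theorem mem_sectionalCurvatures_iff (g : Metric E M) {p q : M}
    (hq : q ∈ (extChartAt 𝓘(ℝ, E) p).source) (k : ℝ) :
    k ∈ sectionalCurvatures g q ↔ ∃ u v : E, LinearIndependent ℝ ![u, v] ∧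
      metricInChart g p (extChartAt 𝓘(ℝ, E) p q)
        (LocalMetric.curvature (metricInChart g p) (extChartAt 𝓘(ℝ, E) p q) v v u) u /
      (metricInChart g p (extChartAt 𝓘(ℝ, E) p q) u u *
        metricInChart g p (extChartAt 𝓘(ℝ, E) p q) v v -
        metricInChart g p (extChartAt 𝓘(ℝ, E) p q) u v ^ 2) = k := by
  obtain ⟨L, hL, hR⟩ := exists_linearEquiv_chart g hq
  have key : ∀ u v, sectionalCurvature g q u v = metricInChart g p (extChartAt 𝓘(ℝ, E) p q)
        (LocalMetric.curvature (metricInChart g p) (extChartAt 𝓘(ℝ, E) p q) (L v) (L v) (L u))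
        (L u) /
      (metricInChart g p (extChartAt 𝓘(ℝ, E) p q) (L u) (L u) *
        metricInChart g p (extChartAt 𝓘(ℝ, E) p q) (L v) (L v) -
        metricInChart g p (extChartAt 𝓘(ℝ, E) p q) (L u) (L v) ^ 2) := by
    intro u v
    rw [← hR, hL, hL, hL, hL]
    rfl
  constructor
  · rintro ⟨u, v, h, rfl⟩
    exact ⟨L u, L v, (linearIndependent_pair_map_iff L u v).2 h, (key u v).symm⟩
  · rintro ⟨u, v, h, rfl⟩
    obtain ⟨u, rfl⟩ := L.surjective u
    obtain ⟨v, rfl⟩ := L.surjective v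
    exact ⟨u, v, (linearIndependent_pair_map_iff L u v).1 h, key u v⟩

theorem trace_curvature_metricInChart {g : Metric E M} (hRic : IsRicciFlat g) (p : M) {y : E}
    (hy : y ∈ (extChartAt 𝓘(ℝ, E) p).target) (v w : E) :
    LinearMap.trace ℝ E (LocalMetric.curvature (metricInChart g p) y v w) = 0 := by
  obtain ⟨q, hq, rfl⟩ : ∃ q ∈ (extChartAt 𝓘(ℝ, E) p).source, extChartAt 𝓘(ℝ, E) p q = y :=
    ⟨_, (extChartAt 𝓘(ℝ, E) p).map_target hy, (extChartAt 𝓘(ℝ, E) p).right_inv hy⟩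
  obtain ⟨L, -, hR⟩ := exists_linearEquiv_chart g hq
  obtain ⟨v, rfl⟩ := L.surjective v
  obtain ⟨w, rfl⟩ := L.surjective w
  rw [← hRic q v w, ricci, ← LinearMap.trace_conj' (curvature g q v w) L]
  congr 1
  ext u
  rw [LinearEquiv.conj_apply_apply, hR, L.apply_symm_apply]

end Charts

section Compact

variable {E : Type*} [NormedAddCommGroup E] [InnerProductSpace ℝ E] [FiniteDimensional ℝ E]
  {M : Type*} [TopologicalSpace M] [ChartedSpace E M] [IsManifold 𝓘(ℝ, E) ∞ M]

/-- Makes `Kmax` an actual upper bound: the real `sSup` of an unbounded set would be the default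
value `0`. -/
theorem bddAbove_sectionalCurvatures (g : Metric E M) (p : M) :
    BddAbove (sectionalCurvatures g p) := by
  obtain ⟨κ, hκ⟩ := (isMetricOn_metricInChart g p).exists_forall_sectional_le
    (isCompact_singleton (x := extChartAt 𝓘(ℝ, E) p p))
    (Set.singleton_subset_iff.2 (mem_extChartAt_target p))
  refine ⟨κ, fun k hk => ?_⟩
  obtain ⟨u, v, h, rfl⟩ := (mem_sectionalCurvatures_iff g (mem_extChartAt_source p) k).1 hk
  exact hκ _ rfl u v h

/-- On a compact manifold the sectional curvature attains its minimum. -/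
theorem exists_forall_le_sectionalCurvatures [CompactSpace M] [Nonempty M]
    (hE : 2 ≤ Module.finrank ℝ E) (g : Metric E M) :
    ∃ (q : M) (k : ℝ), k ∈ sectionalCurvatures g q ∧
      ∀ p, ∀ k' ∈ sectionalCurvatures g p, k ≤ k' := by
  -- A compact neighbourhood inside one chart supplies a lower bound near `p` that is itself a
  -- sectional curvature somewhere. The least of finitely many such bounds is the attained global
  -- minimum.
  have hloc : ∀ p : M, ∃ W ∈ nhds p, ∃ k, (∃ q, k ∈ sectionalCurvatures g q) ∧
      ∀ q ∈ W, ∀ k' ∈ sectionalCurvatures g q, k ≤ k' := by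
    intro p
    have hG := isMetricOn_metricInChart g p
    obtain ⟨C, hC, hpC, hCU⟩ := exists_compact_subset hG.isOpen (mem_extChartAt_target p)
    obtain ⟨y, hy, u, v, h, hmin⟩ :=
      hG.exists_forall_le_sectional hC hCU ⟨_, interior_subset hpC⟩ hE
    have hW : (extChartAt 𝓘(ℝ, E) p).source ∩ extChartAt 𝓘(ℝ, E) p ⁻¹' interior C ∈ nhds p :=
      Filter.inter_mem (extChartAt_source_mem_nhds p)
        ((continuousAt_extChartAt p).preimage_mem_nhds (isOpen_interior.mem_nhds hpC))
    have hyq := (extChartAt 𝓘(ℝ, E) p).right_inv (hCU hy)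
    refine ⟨_, hW, _, ⟨(extChartAt 𝓘(ℝ, E) p).symm y, (mem_sectionalCurvatures_iff g
      ((extChartAt 𝓘(ℝ, E) p).map_target (hCU hy)) _).2 ⟨u, v, h, by rw [hyq]⟩⟩, ?_⟩
    rintro q ⟨hq, hqC⟩ k' hk'
    obtain ⟨u', v', h', rfl⟩ := (mem_sectionalCurvatures_iff g hq k').1 hk'
    exact hmin _ (interior_subset hqC) u' v' h'
  choose W hW k hk hmin using hloc
  obtain ⟨t, ht⟩ := isCompact_univ.elim_nhds_subcover W fun p _ => hW p
  have htne : t.Nonempty := by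
    obtain ⟨x⟩ := ‹Nonempty M›
    obtain ⟨p, hp, -⟩ := Set.mem_iUnion₂.1 (ht.2 (Set.mem_univ x))
    exact ⟨p, hp⟩
  obtain ⟨p, -, hp⟩ := t.exists_min_image k htne
  obtain ⟨q, hq⟩ := hk p
  refine ⟨q, k p, hq, fun x k' hk' => ?_⟩
  obtain ⟨p', hp', hx⟩ := Set.mem_iUnion₂.1 (ht.2 (Set.mem_univ x))
  exact (hp p' hp').trans (hmin p' x hx k' hk')

theorem isFlat_of_forall_sectionalCurvatures_eq_zero (g : Metric E M)
    (h : ∀ p, ∀ k ∈ sectionalCurvatures g p, k = 0) : IsFlat g := by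
  intro p u v w
  have hp := mem_extChartAt_source (I := 𝓘(ℝ, E)) p
  have hG := isMetricOn_metricInChart g p
  have hy := mem_extChartAt_target (I := 𝓘(ℝ, E)) p
  obtain ⟨L, -, hR⟩ := exists_linearEquiv_chart g hp
  apply L.injective
  rw [map_zero, hR]
  refine hG.curvature_eq_zero_of_forall_curvature_inner hy (fun u v => ?_) _ _ _
  by_cases hi : LinearIndependent ℝ ![u, v]
  · have := h p _ ((mem_sectionalCurvatures_iff g hp _).2 ⟨u, v, hi, rfl⟩)
    exact (div_eq_zero_iff.1 this).resolve_right (hG.area_pos hy hi).ne'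
  · exact (IsMetricOn.curvature_inner_and_area_eq_zero hi).1

end Compact

section FourDim

variable {E : Type*} [NormedAddCommGroup E] [InnerProductSpace ℝ E] [FiniteDimensional ℝ E]
  {M : Type*} [TopologicalSpace M] [ChartedSpace E M] [IsManifold 𝓘(ℝ, E) ∞ M]

/-- At a point where the sectional curvature of a Ricci-flat four-manifold attains its global
minimum `k`, an upper bound `κ` for the sectional curvatures satisfies `3 k² ≤ 8 (κ + k / 2)²`. -/
theorem sq_le_of_forall_le_sectionalCurvatures (hE : Module.finrank ℝ E = 4) {g : Metric E M}
    (hRic : IsRicciFlat g) {q : M} {k κ : ℝ} (hk : k ∈ sectionalCurvatures g q)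
    (hmin : ∀ p, ∀ k' ∈ sectionalCurvatures g p, k ≤ k')
    (hmax : ∀ k' ∈ sectionalCurvatures g q, k' ≤ κ) :
    3 * k ^ 2 ≤ 8 * (κ + k / 2) ^ 2 := by
  have hq := mem_extChartAt_source (I := 𝓘(ℝ, E)) q
  have hy := mem_extChartAt_target (I := 𝓘(ℝ, E)) q
  have hG := isMetricOn_metricInChart g q
  obtain ⟨u, v, h, hkuv⟩ := (mem_sectionalCurvatures_iff g hq k).1 hk
  obtain ⟨u', v', a, b, c, rfl, rfl, hu, hv, huv, ha, hc⟩ :=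
    exists_orthonormal_pair _ (hG.pos _ hy) h
  -- Replaces the minimising pair by a basis of the same plane that is orthonormal for the metric at
  -- the point.
  rw [hG.area_combination hy, hG.curvature_inner_combination hy,
    mul_div_mul_left _ _ (by positivity), hu, hv, huv] at hkuv
  obtain ⟨e, he, he0, he1⟩ :=
    exists_basis_of_orthonormal_pair hE _ (hG.symm _ hy) (hG.pos _ hy) hu hv huv
  refine hG.sq_le_of_pinched hy (fun x hx => trace_curvature_metricInChart hRic q hx) e he ?_ ?_ ?_
  · rw [he0, he1, ← hkuv]; simp
  · intro x hx u v
    by_cases hi : LinearIndependent ℝ ![u, v]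
    · have hx' := (extChartAt 𝓘(ℝ, E) q).right_inv hx
      have := hmin _ _ ((mem_sectionalCurvatures_iff g
        ((extChartAt 𝓘(ℝ, E) q).map_target hx) _).2 ⟨u, v, hi, rfl⟩)
      rw [hx', le_div_iff₀ (hG.area_pos hx hi)] at this
      exact this
    · obtain ⟨h1, h2⟩ :=
        IsMetricOn.curvature_inner_and_area_eq_zero (G := metricInChart g q) (y := x) hi
      rw [h1, h2, mul_zero]
  · intro u v
    by_cases hi : LinearIndependent ℝ ![u, v]
    · have := hmax _ ((mem_sectionalCurvatures_iff g hq _).2 ⟨u, v, hi, rfl⟩)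
      rwa [div_le_iff₀ (hG.area_pos hy hi)] at this
    · obtain ⟨h1, h2⟩ := IsMetricOn.curvature_inner_and_area_eq_zero (G := metricInChart g q)
        (y := extChartAt 𝓘(ℝ, E) q q) hi
      rw [h1, h2, mul_zero]

end FourDim

end Riemannian

end

/-- A compact Ricci-flat `4`-manifold with `K_max ≤ -c K_min` at every point, where
`0 ≤ c < (2 + √6) / 4`, is flat. -/
theorem theorem1p1 {M : Type*} [TopologicalSpace M] [T2Space M] [CompactSpace M]
    [ChartedSpace (EuclideanSpace ℝ (Fin 4)) M] [IsManifold (𝓡 4) ∞ M]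
    (g : Riemannian.Metric (EuclideanSpace ℝ (Fin 4)) M)
    (hRic : Riemannian.IsRicciFlat g)
    (c : ℝ) (hc0 : 0 ≤ c) (hc : c < (2 + √6) / 4)
    (hK : ∀ p : M, Riemannian.Kmax g p ≤ -c * Riemannian.Kmin g p) :
    Riemannian.IsFlat g := by
  rcases isEmpty_or_nonempty M with hM | hM
  · exact fun p => (hM.false p).elim
  obtain ⟨q, k, hk, hmin⟩ :=
    Riemannian.exists_forall_le_sectionalCurvatures (by simp) g
  have hle : ∀ p, ∀ k' ∈ Riemannian.sectionalCurvatures g p, k' ≤ -c * Riemannian.Kmin g p :=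
    fun p k' hk' => (le_csSup (Riemannian.bddAbove_sectionalCurvatures g p) hk').trans (hK p)
  have hKmin : Riemannian.Kmin g q = k := IsLeast.csInf_eq ⟨hk, hmin q⟩
  have hmax := hle q
  rw [hKmin] at hmax
  -- The upper bound applied to `k` itself gives `k ≤ -c * k`, that is `(1 + c) * k ≤ 0`.
  have hk0 : k ≤ 0 := by nlinarith [hmax k hk]
  have hsq := Riemannian.sq_le_of_forall_le_sectionalCurvatures (by simp) hRic hk hmin hmax
  -- With `κ = -c * k`, `hsq` reads `3 k² ≤ 8 k² (c - 1/2)²`. For `k ≠ 0` this contradicts `-√6/4 <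
  -- -1/2 ≤ c - 1/2 < √6/4`; the leftmost inequality is where `2 < √6` enters.
  have hkz : k = 0 := by
    by_contra hne
    have h6 : √6 ^ 2 = 6 := Real.sq_sqrt (by norm_num)
    have h6pos : 2 < √6 := Real.lt_sqrt_of_sq_lt (by norm_num)
    have h1 : 0 < k ^ 2 := by positivity
    have h2 : (c - 1 / 2) ^ 2 < 3 / 8 := by nlinarith
    nlinarith
  refine Riemannian.isFlat_of_forall_sectionalCurvatures_eq_zero g fun p k' hk' => ?_
  have h1 := hmin p k' hk'
  -- The global minimum being zero, `Kmin` is nonnegative everywhere, and the pinching gives `k' ≤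
  -- -c * Kmin ≤ 0`.
  have h2 : 0 ≤ Riemannian.Kmin g p :=
    Real.sInf_nonneg fun k' hk' => hkz ▸ hmin p k' hk'
  have h3 := hle p k' hk'
  nlinarith
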